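/- Let $g\ge 2$, let $\mathbb D$ be the Poincaré disk with its hyperbolic metric $d$ (curvature $-1$), and let $D_g\subset\mathbb D$ be the closed regular hyperbolic $4g$-gon centred at the origin with angle sum $2\pi$, with vertices $v_0,\dots,v_{4g-1}$ in counterclockwise order such that the midpoint of $[v_0,v_1]$ lies on the positive real axis, and with sides $s_j=[v_j,v_{j+1}]$ (indices modulo $4g$). Let $\Gamma_g$ be the generalized Bolza group, i.e. the group of isometries of $\mathbb D$ generated by the transformations $f_j(z)=\frac{az+b_j}{\overline{b_j}z+a}$, $j=0,\dots,4g-1$, where $a=\cot\frac{\pi}{4g}$ and $b_j=e^{ij\pi/2g}\sqrt{\cot^2\frac{\pi}{4g}-1}$; let $M_g=\mathbb D/\Gamma_g$ be the generalized Bolza surface and $\pi_g:\mathbb D\to M_g$ the projection. Let $D_{\mathcal N}$ be the union of all $f(D_g)$ with $f\in\Gamma_g$ and $f(D_g)\cap D_g\ne\emptyset$. The original domain $\mathring D\subset D_g$ consists of the interior of $D_g$, the vertex $v_0$, and the sides $s_{2g},\dots,s_{4g-1}$ without their endpoints. The Weierstrass points of $M_g$ are the images under $\pi_g$ of the origin,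 of the vertices of $D_g$ and of the midpoints of the sides of $D_g$. Let $Q\subset M_g$ be a finite set containing all Weierstrass points. A Delaunay triangle of $\pi_g^{-1}(Q)$ is a hyperbolic triangle with vertices in $\pi_g^{-1}(Q)$ and with a circumscribed hyperbolic circle whose open disk contains no point of $\pi_g^{-1}(Q)$; a Delaunay triangulation of $\pi_g^{-1}(Q)$ is a triangulation of $\mathbb D$ with vertex set $\pi_g^{-1}(Q)$ all of whose faces are Delaunay triangles. Then, for every Delaunay triangulation of $\pi_g^{-1}(Q)$, each face with at least one vertex in $\mathring D$ is contained in $D_{\mathcal N}$; moreover, each Delaunay triangle of $\pi_g^{-1}(Q)$ with at least one vertex in $\mathring D$ is contained in $D_{\mathcal N}$. -/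

import Mathlib

noncomputable section

namespace Bolza

open Complex ComplexConjugate
open scoped UnitDisc

/-! ### Hyperbolic geometry in the Poincaré disk -/

/-- The hyperbolic distance of curvature `-1` in the Poincaré disk:
`sinh (d(z,w)/2) = |z - w| / √((1 - |z|²)(1 - |w|²))`. -/
def hdist (z w : 𝔻) : ℝ :=
  2 * Real.arsinh (‖(z : ℂ) - w‖ / √((1 - ‖(z : ℂ)‖ ^ 2) * (1 - ‖(w : ℂ)‖ ^ 2)))

/-- The geodesic segment between two points. -/
def hsegment (z w : 𝔻) : Set 𝔻 :=
  {x | hdist z x + hdist x w = hdist z w}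

/-- A set is (hyperbolically) convex if it contains the geodesic segment between any two of its
points. -/
def HConvex (S : Set 𝔻) : Prop :=
  ∀ z ∈ S, ∀ w ∈ S, hsegment z w ⊆ S

/-- The hyperbolic convex hull: the smallest convex set containing `S`. -/
def hconvexHull (S : Set 𝔻) : Set 𝔻 :=
  ⋂₀ {C | HConvex C ∧ S ⊆ C}

/-- `‖b̄ z + ā‖² - ‖a z + b‖² = (‖a‖² - ‖b‖²) (1 - ‖z‖²)`. -/
theorem normSq_sub_normSq (a b z : ℂ) :
    normSq (conj b * z + conj a) - normSq (a * z + b) =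
      (normSq a - normSq b) * (1 - normSq z) := by
  simp only [normSq_apply, add_re, add_im, mul_re, mul_im, conj_re, conj_im]
  ring

theorem normSq_lt (a b : ℂ) (h : normSq a - normSq b = 1) (z : 𝔻) :
    normSq (a * z + b) < normSq (conj b * z + conj a) := by
  have h1 := normSq_sub_normSq a b z
  have h2 := z.normSq_lt_one
  rw [h, one_mul] at h1
  linarith

theorem denom_ne_zero (a b : ℂ) (h : normSq a - normSq b = 1) (z : 𝔻) :
    conj b * z + conj a ≠ 0 := by
  rw [← normSq_pos]
  exact lt_of_le_of_lt (normSq_nonneg _) (normSq_lt a b h z)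

theorem norm_moebius_lt_one (a b : ℂ) (h : normSq a - normSq b = 1) (z : 𝔻) :
    ‖(a * z + b) / (conj b * z + conj a)‖ < 1 := by
  have h1 := normSq_lt a b h z
  have h0 : 0 < ‖conj b * (z : ℂ) + conj a‖ := norm_pos_iff.2 (denom_ne_zero a b h z)
  rw [norm_div, div_lt_one h0]
  rw [normSq_eq_norm_sq, normSq_eq_norm_sq] at h1
  exact lt_of_pow_lt_pow_left₀ 2 h0.le h1

/-- The map `z ↦ (a z + b) / (b̄ z + ā)` of the disk, for `|a|² - |b|² = 1`. -/
def moebiusFun (a b : ℂ) (h : normSq a - normSq b = 1) (z : 𝔻) : 𝔻 :=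
  UnitDisc.mk ((a * z + b) / (conj b * z + conj a)) (norm_moebius_lt_one a b h z)

theorem moebiusFun_leftInv (a b : ℂ) (h : normSq a - normSq b = 1)
    (h' : normSq (conj a) - normSq (-b) = 1) :
    Function.LeftInverse (moebiusFun (conj a) (-b) h') (moebiusFun a b h) := by
  intro z
  have h0 := denom_ne_zero a b h z
  have hd := denom_ne_zero (conj a) (-b) h' (moebiusFun a b h z)
  apply UnitDisc.coe_injective
  simp only [moebiusFun, UnitDisc.coe_mk, map_neg, conj_conj] at hd ⊢
  rw [div_eq_iff hd]
  have hq := div_mul_cancel₀ (a * (z : ℂ) + b) h0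
  linear_combination hq

/-- The orientation-preserving isometry `z ↦ (a z + b) / (b̄ z + ā)`, `|a|² - |b|² = 1`. -/
def moebius (a b : ℂ) (h : normSq a - normSq b = 1) : Equiv.Perm 𝔻 where
  toFun := moebiusFun a b h
  invFun := moebiusFun (conj a) (-b) (by rwa [normSq_conj, normSq_neg])
  left_inv := moebiusFun_leftInv a b h _
  right_inv z := by
    have := moebiusFun_leftInv (conj a) (-b) (by rwa [normSq_conj, normSq_neg])
      (by rwa [conj_conj, neg_neg]) z
    simpa only [conj_conj, neg_neg] using this

/-! ### Delaunay triangulations of a set of points of the hyperbolic plane -/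

/-- A Delaunay triangle of a point set `P`, given by its three vertices: the vertices belong to
`P`, and they lie on a hyperbolic circle whose open disk contains no point of `P`. (Three distinct
points of a circle are never collinear, so the triangle is not degenerate.) -/
def IsDelaunayTriangle (P : Set 𝔻) (t : Finset 𝔻) : Prop :=
  t.card = 3 ∧ (t : Set 𝔻) ⊆ P ∧
    ∃ (c : 𝔻) (r : ℝ), (∀ v ∈ t, hdist c v = r) ∧ ∀ p ∈ P, r ≤ hdist c p

/-- `T` is the set of faces (given by their vertices) of a Delaunay triangulation of `P`: a
triangulation of the hyperbolic plane with vertex set `P` all of whose faces are Delaunay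
triangles. It need not be unique, as more than three points of `P` may lie on a common empty
circle. -/
structure IsDelaunayTriangulation (P : Set 𝔻) (T : Set (Finset 𝔻)) : Prop where
  delaunay : ∀ t ∈ T, IsDelaunayTriangle P t
  vertices : ∀ p ∈ P, ∃ t ∈ T, p ∈ t
  cover : ⋃ t ∈ T, hconvexHull (t : Set 𝔻) = Set.univ
  inter : ∀ t ∈ T, ∀ t' ∈ T,
    hconvexHull (t : Set 𝔻) ∩ hconvexHull (t' : Set 𝔻) = hconvexHull ((t : Set 𝔻) ∩ t')

/-! ### The generalized Bolza surface of genus `g` -/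

theorem one_le_cot {g : ℕ} (hg : 2 ≤ g) : 1 ≤ Real.cot (Real.pi / (4 * g)) := by
  have hpi := Real.pi_pos
  have hg' : (2 : ℝ) ≤ g := by exact_mod_cast hg
  have h4 : Real.pi / (4 * g) ≤ Real.pi / 4 := by
    apply div_le_div_of_nonneg_left hpi.le (by norm_num) (by linarith)
  have h0 : 0 < Real.pi / (4 * g) := by positivity
  have hs : 0 < Real.sin (Real.pi / (4 * g)) := Real.sin_pos_of_pos_of_lt_pi h0 (by linarith)
  rw [Real.cot_eq_cos_div_sin, one_le_div hs, ← Real.cos_pi_div_two_sub]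
  exact Real.cos_le_cos_of_nonneg_of_le_pi h0.le (by linarith) (by linarith)

theorem generator_det {g : ℕ} (hg : 2 ≤ g) (j : ℕ) :
    normSq (Real.cot (Real.pi / (4 * g)) : ℂ) -
      normSq (exp (I * j * Real.pi / (2 * g)) * (√(Real.cot (Real.pi / (4 * g)) ^ 2 - 1) : ℝ)) =
      1 := by
  have h1 := one_le_cot hg
  have he : ‖exp (I * j * Real.pi / (2 * g))‖ = 1 := by
    have : I * j * Real.pi / (2 * g) = ((j * Real.pi / (2 * g) : ℝ) : ℂ) * I := by
      push_cast; ring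
    rw [this, norm_exp_ofReal_mul_I]
  rw [normSq_mul, normSq_ofReal, normSq_ofReal, normSq_eq_norm_sq, he, Real.mul_self_sqrt]
  · ring
  · nlinarith

/-- The generator `f_j`, given by the matrix with rows
`(cot (π/4g), exp (ijπ/2g) √(cot² (π/4g) - 1))` and
`(exp (-ijπ/2g) √(cot² (π/4g) - 1), cot (π/4g))`. -/
def generator (g : ℕ) (hg : 2 ≤ g) (j : ℕ) : Equiv.Perm 𝔻 :=
  moebius (Real.cot (Real.pi / (4 * g)) : ℂ)
    (exp (I * j * Real.pi / (2 * g)) * (√(Real.cot (Real.pi / (4 * g)) ^ 2 - 1) : ℝ))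
    (generator_det hg j)

/-- The generalized Bolza group `Γ_g`, generated by `f_0, …, f_{4g-1}`. -/
def group (g : ℕ) (hg : 2 ≤ g) : Subgroup (Equiv.Perm 𝔻) :=
  Subgroup.closure {f | ∃ j < 4 * g, f = generator g hg j}

theorem norm_vertex_lt_one {g : ℕ} (hg : 2 ≤ g) (j : ℕ) :
    ‖(√(Real.cos (Real.pi / (2 * g))) : ℝ) *
      exp (I * (2 * j - 1) * Real.pi / (4 * g))‖ < 1 := by
  have hpi := Real.pi_pos
  have hg' : (2 : ℝ) ≤ g := by exact_mod_cast hg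
  have he : ‖exp (I * (2 * j - 1) * Real.pi / (4 * g))‖ = 1 := by
    have : I * (2 * j - 1) * Real.pi / (4 * g) =
        (((2 * j - 1) * Real.pi / (4 * g) : ℝ) : ℂ) * I := by
      push_cast; ring
    rw [this, norm_exp_ofReal_mul_I]
  rw [norm_mul, he, mul_one, norm_real, Real.norm_of_nonneg (Real.sqrt_nonneg _),
    Real.sqrt_lt' one_pos, one_pow, ← Real.cos_zero]
  have h4 : Real.pi / (2 * g) ≤ Real.pi / 4 := by
    apply div_le_div_of_nonneg_left hpi.le (by norm_num) (by linarith)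
  exact Real.cos_lt_cos_of_nonneg_of_le_pi le_rfl (by linarith) (by positivity)

/-- The vertices `v_j` (indices modulo `4g`) of the regular hyperbolic `4g`-gon, centred at the
origin, with all interior angles equal to `π/2g`, such that the midpoint of `[v_0, v_1]` lies on
the positive real axis. Their hyperbolic distance `R` to the origin is given by
`cosh R = cot² (π/4g)`, that is, their Euclidean norm is `tanh (R/2) = √(cos (π/2g))`. -/
def vertex (g : ℕ) (hg : 2 ≤ g) (j : ℕ) : 𝔻 :=
  UnitDisc.mk ((√(Real.cos (Real.pi / (2 * g))) : ℝ) * exp (I * (2 * j - 1) * Real.pi / (4 * g)))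
    (norm_vertex_lt_one hg j)

/-- The side `s_j = [v_j, v_{j+1}]`. -/
def side (g : ℕ) (hg : 2 ≤ g) (j : ℕ) : Set 𝔻 :=
  hsegment (vertex g hg j) (vertex g hg (j + 1))

/-- The fundamental `4g`-gon `D_g`. -/
def polygon (g : ℕ) (hg : 2 ≤ g) : Set 𝔻 :=
  hconvexHull {v | ∃ j < 4 * g, v = vertex g hg j}

/-- The original domain: the interior of `D_g`, the vertex `v_0`, and the sides
`s_{2g}, …, s_{4g-1}` without their endpoints. -/
def originalDomain (g : ℕ) (hg : 2 ≤ g) : Set 𝔻 :=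
  interior (polygon g hg) ∪ {vertex g hg 0} ∪
    {z | ∃ j, 2 * g ≤ j ∧ j < 4 * g ∧ z ∈ side g hg j ∧ z ≠ vertex g hg j ∧
      z ≠ vertex g hg (j + 1)}

/-- The set `N` of neighboring translations: the `f ∈ Γ_g` such that `f(D_g)` meets `D_g`. -/
def neighbors (g : ℕ) (hg : 2 ≤ g) : Set (Equiv.Perm 𝔻) :=
  {f | f ∈ group g hg ∧ ((f '' polygon g hg) ∩ polygon g hg).Nonempty}

/-- The union `D_N` of the neighboring regions of `D_g`. -/
def neighborhood (g : ℕ) (hg : 2 ≤ g) : Set 𝔻 :=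
  ⋃ f ∈ neighbors g hg, f '' polygon g hg

/-- The generalized Bolza surface `M_g`, as the orbit space of the action of `Γ_g`. -/
abbrev Surface (g : ℕ) (hg : 2 ≤ g) : Type :=
  MulAction.orbitRel.Quotient (group g hg) 𝔻

/-- The covering projection `π_g`. -/
def proj (g : ℕ) (hg : 2 ≤ g) (z : 𝔻) : Surface g hg :=
  Quotient.mk (MulAction.orbitRel (group g hg) 𝔻) z

/-- The Weierstrass points of `M_g`: the projections of the origin, of the vertices of `D_g` and of
the midpoints of its sides. -/
def weierstrassPoints (g : ℕ) (hg : 2 ≤ g) : Set (Surface g hg) :=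
  proj g hg '' ({0} ∪ {v | ∃ j < 4 * g, v = vertex g hg j} ∪
    {m | ∃ j < 4 * g, m ∈ side g hg j ∧ hdist (vertex g hg j) m = hdist m (vertex g hg (j + 1))})

end Bolza

end

noncomputable section

namespace Bolza

open Complex ComplexConjugate
open scoped UnitDisc

/-! ### Trigonometric estimates -/

/-! A closed disk is convex, so a Delaunay triangle lies in its circumscribed disk, and it suffices
to show that a closed disk which meets `D_g` and has no Weierstrass point in its interior lies in
`D_N`. The computations use the hyperboloid model: segments are nonnegative combinations, lines are
zero sets of linear forms, and `Γ_g` acts linearly. Let `C` be the centre, `k` the hyperbolic cosine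
of the radius, and `A = ang g`.

The metric core is `disk_far_from_side`. A disk that avoids the origin and the side midpoints can
reach the line of a side only if `C` is seen from the origin at an angle less than `2A` from the
midpoint of that side (`sideForm_pos_of_isClear`). Hence, if `C` is within angle `A` of a vertex
direction, the disk can reach only the two side lines through that vertex, and its part in the wedge
there lies in `D_g` (`mem_polygon_of_inSector`).

Now fix a vertex `v` whose sector contains `C`, and turn around it. For a side `s_j` at `v`, the
inverse of `f_j` carries `v` to another vertex and turns the picture there by the interior angle
`2A`. The moved centre lies in the sector of the new vertex (`inSector_generator_inv`): the point of
`D_g` in the disk is moved to the far side of the line opposite to `s_j`, so the moved disk reaches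
that line, and the moved centre is within `2A` of its midpoint direction; as `f_j` is a translation
along an axis, `C` also stays on its side of the axis. At most `2g` turns bring a given point `x` of
the disk into the wedge of the current vertex (`exists_turn`, `exists_walk`), hence into `D_g`. If
`h` is the composite, `h⁻¹(D_g)` contains both `x` and `v`, so it is a neighboring region. -/

theorem cos_sq_ge {A : ℝ} (hA0 : 0 < A) (hA : A ≤ Real.pi / 8) : 0.85 ≤ Real.cos A ^ 2 := by
  have h1 : Real.cos (Real.pi / 4) ≤ Real.cos (2 * A) :=
    Real.cos_le_cos_of_nonneg_of_le_pi (by linarith) (by linarith [Real.pi_pos]) (by linarith)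
  rw [Real.cos_pi_div_four, Real.cos_two_mul] at h1
  -- By the half-angle formula `cos² A ≥ (1 + √2 / 2) / 2`, and `1.4 ≤ √2` turns this into `0.85`.
  have h2 : (1.4 : ℝ) ≤ √2 := Real.le_sqrt_of_sq_le (by norm_num)
  linarith

/-- With `x = cos² A`, squaring gives `x³ ≤ 2x - 1`, that is `(1 - x)(x² + x - 1) ≥ 0`, which holds
for `0.85 ≤ x ≤ 1`. -/
theorem cos_cube_le {A R : ℝ} (hA0 : 0 < A) (hA : A ≤ Real.pi / 8) (hR0 : 0 < R)
    (hR : R ^ 2 = Real.cos (2 * A)) : Real.cos A ^ 3 ≤ R := by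
  have h1 := cos_sq_ge hA0 hA
  apply le_of_sq_le_sq _ hR0.le
  rw [hR, Real.cos_two_mul]
  have h2 := Real.cos_sq_le_one A
  nlinarith [mul_nonneg (sub_nonneg.2 h2) (by nlinarith : 0 ≤ (Real.cos A ^ 2) ^ 2 + Real.cos A ^ 2 - 1)]

set_option maxHeartbeats 1000000 in
/-- If a disk with centre `C` does not contain the origin and the midpoint of a side in its
interior, where `θ ≤ A` is the angle between `C` and the midpoint, then it does not meet the
lines of the sides whose midpoint is at an angle at least `2 * A + θ`. -/
theorem disk_far_from_side {A R θ C₀ ρ k q : ℝ} (hA0 : 0 < A) (hA : A ≤ Real.pi / 8)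
    (hR0 : 0 < R) (hR : R ^ 2 = Real.cos (2 * A)) (hθ0 : 0 ≤ θ) (hθ : θ ≤ A) (hC₀ : 0 < C₀)
    (hρ : 0 ≤ ρ) (hC : C₀ ^ 2 = 1 + ρ ^ 2) (hk : 1 ≤ k) (hk0 : k ≤ C₀)
    (hkm : k * Real.sin A ≤ C₀ * Real.cos A - ρ * Real.cos θ * R)
    (hq : q ≤ Real.cos (2 * A + θ)) :
    0 < C₀ * R - Real.cos A * ρ * q ∧
      k ^ 2 * Real.sin A ^ 2 < (C₀ * R - Real.cos A * ρ * q) ^ 2 + Real.sin A ^ 2 := by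
  have hpi := Real.pi_pos
  have hs : 0 < Real.sin A := Real.sin_pos_of_pos_of_lt_pi hA0 (by linarith)
  have hc : 0 < Real.cos A := Real.cos_pos_of_mem_Ioo ⟨by linarith, by linarith⟩
  have hcs : Real.sin A < Real.cos A := by
    rw [← Real.sin_pi_div_two_sub]
    exact Real.sin_lt_sin_of_lt_of_le_pi_div_two (by linarith) (by linarith) (by linarith)
  have hc3 := cos_cube_le hA0 hA hR0 hR
  have hc85 := cos_sq_ge hA0 hA
  have hone := Real.sin_sq_add_cos_sq A
  have hR' : R ^ 2 = Real.cos A ^ 2 - Real.sin A ^ 2 := by rw [hR, Real.cos_two_mul']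
  have hc1 : 0 < Real.cos θ := Real.cos_pos_of_mem_Ioo ⟨by linarith, by linarith⟩
  have hsA : Real.sin A ≤ Real.sin (A + θ) :=
    Real.sin_le_sin_of_le_of_le_pi_div_two (by linarith) (by linarith) (by linarith)
  have hsub : Real.cos θ - Real.cos (2 * A + θ) = 2 * Real.sin A * Real.sin (A + θ) := by
    rw [Real.cos_sub_cos, show (θ - (2 * A + θ)) / 2 = -A by ring,
      show (θ + (2 * A + θ)) / 2 = A + θ by ring, Real.sin_neg]
    ring
  have hadd : Real.cos θ + Real.cos (2 * A + θ) = 2 * Real.cos A * Real.cos (A + θ) := by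
    rw [Real.cos_add_cos, show (θ - (2 * A + θ)) / 2 = -A by ring,
      show (θ + (2 * A + θ)) / 2 = A + θ by ring, Real.cos_neg]
    ring
  have hhalf : 0 ≤ Real.sin (θ / 2) := Real.sin_nonneg_of_nonneg_of_le_pi (by linarith) (by linarith)
  have hhalfA : Real.sin (θ / 2) ≤ Real.sin (A + θ / 2) :=
    Real.sin_le_sin_of_le_of_le_pi_div_two (by linarith) (by linarith) (by linarith)
  have hhalf1 : Real.sin (θ / 2) ≤ Real.sin A :=
    Real.sin_le_sin_of_le_of_le_pi_div_two (by linarith) (by linarith) (by linarith)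
  have hcos1 : Real.cos θ = 1 - 2 * Real.sin (θ / 2) ^ 2 := by
    rw [show θ = 2 * (θ / 2) by ring, Real.cos_two_mul']
    have := Real.sin_sq_add_cos_sq (θ / 2)
    ring_nf at this ⊢
    linarith
  have hsin1 : Real.sin θ = 2 * Real.sin (θ / 2) * Real.cos (θ / 2) := by
    rw [← Real.sin_two_mul]; congr 1; ring
  have hcdiff : Real.cos A - Real.cos (A + θ) = 2 * Real.sin (A + θ / 2) * Real.sin (θ / 2) := by
    rw [Real.cos_sub_cos, show (A - (A + θ)) / 2 = -(θ / 2) by ring,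
      show (A + (A + θ)) / 2 = A + θ / 2 by ring, Real.sin_neg]
    ring
  have hρC : ρ < C₀ := lt_of_pow_lt_pow_left₀ 2 hC₀.le (by linarith)
  set s := Real.sin A
  set c := Real.cos A
  set c₁ := Real.cos θ
  set c₂ := Real.cos (2 * A + θ)
  set S := Real.sin (A + θ)
  set t := Real.sin (θ / 2)
  have hc_le : c ≤ 1 := Real.cos_le_one A
  have hS : 0 < S := hs.trans_le hsA
  have h12 : 0 < c₁ - c₂ := by rw [hsub]; positivity
  -- `C₀ * R - c * ρ * q` is `sin A` times the hyperbolic sine of the signed distance from the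
  -- centre to the line, so the two claims say that this distance exceeds the radius. The worst case
  -- is `q = c₂`.
  suffices h : 0 < C₀ * R - c * ρ * c₂ ∧ k ^ 2 * s ^ 2 < (C₀ * R - c * ρ * c₂) ^ 2 + s ^ 2 by
    have hle : C₀ * R - c * ρ * c₂ ≤ C₀ * R - c * ρ * q := by
      have := mul_le_mul_of_nonneg_left hq (mul_nonneg hc.le hρ)
      linarith
    refine ⟨h.1.trans_le hle, h.2.trans_le ?_⟩
    have := pow_le_pow_left₀ h.1.le hle 2
    linarith
  -- The two sides are `sin A` times the hyperbolic cosines of the distances from the centre to the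
  -- origin and to the midpoint; the nearer point gives the sharper bound on `k`.
  rcases le_or_gt (C₀ * s) (C₀ * c - ρ * c₁ * R) with hcase | hcase
  -- `ρ` is the hyperbolic sine of the distance to the origin: the origin is nearer to the centre
  -- than the line is.
  · have key : ρ * s < C₀ * R - c * ρ * c₂ := by
      rcases le_or_gt (s + c * c₂) 0 with hneg | hpos
      · have h1 : ρ * (s + c * c₂) ≤ 0 := mul_nonpos_of_nonneg_of_nonpos hρ hneg
        have h2 : 0 < C₀ * R := mul_pos hC₀ hR0
        linarith
      · have h1 : s + c * c₂ < (c + s) * c₁ := by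
          have : s * (t * t) < s * (c * S) := by
            apply mul_lt_mul_of_pos_left _ hs
            have h3 : t * t ≤ s * s := mul_le_mul hhalf1 hhalf1 hhalf hs.le
            have h4 : s * s < c * s := mul_lt_mul_of_pos_right hcs hs
            have h5 : c * s ≤ c * S := mul_le_mul_of_nonneg_left hsA hc.le
            linarith
          have h6 : c₂ = c₁ - 2 * s * S := by linarith
          rw [h6, hcos1]
          linarith
        have h2 : ρ * c₁ * R * (s + c * c₂) ≤ C₀ * (c - s) * (s + c * c₂) :=
          mul_le_mul_of_nonneg_right (by linarith) hpos.le
        have h3 : C₀ * (c - s) * (s + c * c₂) < C₀ * (c - s) * ((c + s) * c₁) :=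
          mul_lt_mul_of_pos_left h1 (mul_pos hC₀ (by linarith))
        have h4 : (R * c₁) * (ρ * (s + c * c₂)) < (R * c₁) * (C₀ * R) := by
          calc _ = ρ * c₁ * R * (s + c * c₂) := by ring
            _ < C₀ * (c - s) * ((c + s) * c₁) := h2.trans_lt h3
            _ = C₀ * c₁ * (c ^ 2 - s ^ 2) := by ring
            _ = _ := by rw [← hR']; ring
        have h5 := lt_of_mul_lt_mul_left h4 (mul_pos hR0 hc1).le
        linarith
    have hρs : 0 ≤ ρ * s := mul_nonneg hρ hs.le
    refine ⟨hρs.trans_lt key, ?_⟩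
    have h1 := pow_lt_pow_left₀ key hρs two_ne_zero
    have h2 : k ^ 2 ≤ C₀ ^ 2 := pow_le_pow_left₀ (by linarith) hk0 2
    have h3 := mul_le_mul_of_nonneg_right h2 (sq_nonneg s)
    rw [hC] at h3
    linarith [mul_pow ρ s 2]
  · have hρ0 : 0 < ρ := by
      rcases hρ.eq_or_lt with h | h
      · rw [← h] at hcase
        have := mul_lt_mul_of_pos_left hcs hC₀
        linarith
      · exact h
    have hcc2 : c * c₂ ≤ R := by
      have h1 : c₂ ≤ c ^ 2 := by
        have : c₂ ≤ Real.cos (2 * A) :=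
          Real.cos_le_cos_of_nonneg_of_le_pi (by linarith) (by linarith) (by linarith)
        rw [Real.cos_two_mul] at this
        have := Real.cos_sq_le_one A
        linarith
      calc c * c₂ ≤ c * c ^ 2 := mul_le_mul_of_nonneg_left h1 hc.le
        _ = c ^ 3 := by ring
        _ ≤ R := hc3
    have hn : 0 < C₀ * R - c * ρ * c₂ := by
      have h1 := mul_le_mul_of_nonneg_left hcc2 hρ
      have h2 := mul_lt_mul_of_pos_right hρC hR0
      linarith
    refine ⟨hn, ?_⟩
    -- Call the left side `E` and the right side `X > 0`. In `h4` the difference to be estimated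
    -- factors as `ρ * (C₀ * X - ρ * E)`, so `E ≤ X` suffices because `ρ < C₀`.
    have hE : s ^ 2 + c₁ ^ 2 * R ^ 2 - c ^ 2 * c₂ ^ 2 ≤ 2 * R * c * (c₁ - c₂) := by
      have e1 : s ^ 2 + c₁ ^ 2 * R ^ 2 - c ^ 2 * c₂ ^ 2 =
          s ^ 2 * (2 * t * Real.cos (θ / 2)) ^ 2 + c ^ 2 * ((c₁ - c₂) * (c₁ + c₂)) := by
        rw [← hsin1, hR', Real.sin_sq θ]; ring
      have e2 : 4 * s * c * S * (c ^ 2 * (2 * Real.sin (A + θ / 2) * t)) ≤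
          4 * s * c * S * (R - c ^ 2 * Real.cos (A + θ)) := by
        apply mul_le_mul_of_nonneg_left _ (by positivity)
        rw [← hcdiff]
        linarith
      have e3 : s ^ 2 * (2 * t * Real.cos (θ / 2)) ^ 2 ≤
          4 * s * c * S * (c ^ 2 * (2 * Real.sin (A + θ / 2) * t)) := by
        have f1 : s * t ≤ S * Real.sin (A + θ / 2) := mul_le_mul hsA hhalfA hhalf hS.le
        have f2 : Real.cos (θ / 2) ^ 2 ≤ 2 * c ^ 3 := by
          have := Real.cos_sq_le_one (θ / 2)
          have hc2 : c ^ 2 ≤ c := by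
            have := mul_le_mul_of_nonneg_left hc_le hc.le
            linarith
          have := mul_le_mul (hc85.trans hc2) hc85 (by norm_num) hc.le
          linarith
        have f3 : s * t * Real.cos (θ / 2) ^ 2 ≤ S * Real.sin (A + θ / 2) * (2 * c ^ 3) :=
          mul_le_mul f1 f2 (sq_nonneg _) (mul_nonneg hS.le (hhalf.trans hhalfA))
        have f4 := mul_le_mul_of_nonneg_left f3 (by positivity : 0 ≤ 4 * s * t)
        calc _ = 4 * s * t * (s * t * Real.cos (θ / 2) ^ 2) := by ring
          _ ≤ _ := f4
          _ = _ := by ring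
      rw [e1, hadd, hsub]
      calc _ ≤ 4 * s * c * S * (R - c ^ 2 * Real.cos (A + θ)) +
            c ^ 2 * (2 * s * S * (2 * c * Real.cos (A + θ))) := by
              have := e3.trans e2
              linarith
        _ = _ := by ring
    have hκ : 0 ≤ k * s := mul_nonneg (by linarith) hs.le
    have h1 := pow_le_pow_left₀ hκ hkm 2
    have hX : 0 < 2 * R * c * (c₁ - c₂) := by positivity
    have h2 : ρ * (s ^ 2 + c₁ ^ 2 * R ^ 2 - c ^ 2 * c₂ ^ 2) < C₀ * (2 * R * c * (c₁ - c₂)) :=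
      (mul_le_mul_of_nonneg_left hE hρ).trans_lt (mul_lt_mul_of_pos_right hρC hX)
    have h3 := mul_lt_mul_of_pos_left h2 hρ0
    have h4 : (C₀ * R - c * ρ * c₂) ^ 2 + s ^ 2 - (C₀ * c - ρ * c₁ * R) ^ 2 =
        ρ * (C₀ * (2 * R * c * (c₁ - c₂))) -
          ρ * (ρ * (s ^ 2 + c₁ ^ 2 * R ^ 2 - c ^ 2 * c₂ ^ 2)) := by
      linear_combination C₀ ^ 2 * hR' - s ^ 2 * hC
    rw [← mul_pow]
    linarith

/-- The cosine of an odd multiple of `π / (4 * g)` is at most the cosine of `π / (4 * g)`. -/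
theorem cos_odd_mul_le {g : ℕ} (hg : 2 ≤ g) (n : ℤ) :
    Real.cos ((2 * n + 1) * (Real.pi / (4 * g))) ≤ Real.cos (Real.pi / (4 * g)) := by
  have hpi := Real.pi_pos
  have hg' : (2 : ℝ) ≤ g := by exact_mod_cast hg
  set A := Real.pi / (4 * g) with hA
  have hA0 : 0 < A := by positivity
  have hAg : A * (4 * g) = Real.pi := by rw [hA]; field_simp
  set m := round ((2 * n + 1) * A / (2 * Real.pi)) with hm
  have h1 := abs_sub_round ((2 * n + 1) * A / (2 * Real.pi))
  rw [← hm] at h1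
  -- `2π = 8gA` is an even multiple of `A`, so reduction modulo `2π` keeps the multiple odd, hence
  -- nonzero.
  have h2 : (2 * n + 1) * A - m * (2 * Real.pi) = ((2 * (n - m * (4 * g)) + 1 : ℤ) : ℝ) * A := by
    rw [← hAg]; push_cast; ring
  have h3 : |(2 * n + 1) * A - m * (2 * Real.pi)| ≤ Real.pi := by
    have e : (2 * n + 1) * A - m * (2 * Real.pi) =
        ((2 * n + 1) * A / (2 * Real.pi) - m) * (2 * Real.pi) := by field_simp
    rw [e, abs_mul, abs_of_pos (by positivity : 0 < 2 * Real.pi)]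
    have := mul_le_mul_of_nonneg_right h1 (by positivity : 0 ≤ 2 * Real.pi)
    linarith
  rw [← Real.cos_sub_int_mul_two_pi _ m, ← Real.cos_abs ((2 * n + 1) * A - m * (2 * Real.pi))]
  apply Real.cos_le_cos_of_nonneg_of_le_pi hA0.le h3
  rw [h2, abs_mul, abs_of_pos hA0]
  have h4 : (1 : ℤ) ≤ |2 * (n - m * (4 * g)) + 1| := Int.one_le_abs (by omega)
  have h5 : (1 : ℝ) ≤ |((2 * (n - m * (4 * g)) + 1 : ℤ) : ℝ)| := by exact_mod_cast h4
  nlinarith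

/-! ### The hyperboloid model -/

/-- The time coordinate of a point of the disk in the hyperboloid model. -/
def time (z : ℂ) : ℝ := (1 + normSq z) / (1 - normSq z)

/-- The space coordinates of a point of the disk in the hyperboloid model. -/
def space (z : ℂ) : ℂ := ((2 / (1 - normSq z) : ℝ) : ℂ) * z

theorem space_re (z : ℂ) : (space z).re = 2 / (1 - normSq z) * z.re := by
  rw [space, re_ofReal_mul]

theorem space_im (z : ℂ) : (space z).im = 2 / (1 - normSq z) * z.im := by
  rw [space, im_ofReal_mul]

/-- The Minkowski product of two points in the hyperboloid model, which is the hyperbolic cosine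
of their distance. -/
def coshDist (z w : ℂ) : ℝ :=
  time z * time w - (space z).re * (space w).re - (space z).im * (space w).im

theorem coshDist_comm (z w : ℂ) : coshDist z w = coshDist w z := by
  simp only [coshDist]; ring

theorem coshDist_eq {z w : ℂ} (hz : normSq z < 1) (hw : normSq w < 1) :
    coshDist z w = 1 + 2 * normSq (z - w) / ((1 - normSq z) * (1 - normSq w)) := by
  have h1 : 1 - normSq z ≠ 0 := by linarith
  have h2 : 1 - normSq w ≠ 0 := by linarith
  simp only [coshDist, time, space_re, space_im]
  field_simp
  simp only [normSq_apply, sub_re, sub_im]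
  ring

theorem time_pos (z : 𝔻) : 0 < time z := by
  have := z.normSq_lt_one
  exact div_pos (by linarith [normSq_nonneg (z : ℂ)]) (by linarith)

theorem time_sq (z : 𝔻) :
    time z ^ 2 = 1 + (space z).re ^ 2 + (space (z : ℂ)).im ^ 2 := by
  have h1 : 1 - normSq (z : ℂ) ≠ 0 := by linarith [z.normSq_lt_one]
  simp only [time, space_re, space_im]
  field_simp
  simp only [normSq_apply]
  ring

theorem space_div (z : 𝔻) : (z : ℂ) = ((1 / (1 + time z) : ℝ) : ℂ) * space z := by
  have h1 : 1 - normSq (z : ℂ) ≠ 0 := by linarith [z.normSq_lt_one]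
  have h2 : 1 / (1 + time z) * (2 / (1 - normSq (z : ℂ))) = 1 := by
    have : 1 + time z ≠ 0 := by linarith [time_pos z]
    have e : 1 + time z = 2 / (1 - normSq (z : ℂ)) := by
      rw [time]; field_simp; ring
    rw [← e]; field_simp
  rw [space, ← mul_assoc, ← ofReal_mul, h2, ofReal_one, one_mul]

theorem ext_coord {z w : 𝔻} (ht : time z = time w) (hu : space z = space w) : z = w := by
  apply UnitDisc.coe_injective
  rw [space_div z, space_div w, ht, hu]

theorem exists_coord {t : ℝ} {u : ℂ} (ht : 0 < t) (h : t ^ 2 = 1 + u.re ^ 2 + u.im ^ 2) :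
    ∃ z : 𝔻, time z = t ∧ space z = u := by
  have h1 : normSq (((1 / (1 + t) : ℝ) : ℂ) * u) = (t - 1) / (t + 1) := by
    rw [normSq_mul, normSq_ofReal, normSq_apply, show u.re * u.re + u.im * u.im = t ^ 2 - 1 by
      rw [h]; ring]
    field_simp
    ring
  have h2 : ‖((1 / (1 + t) : ℝ) : ℂ) * u‖ < 1 := by
    rw [← sq_lt_one_iff₀ (norm_nonneg _), ← normSq_eq_norm_sq, h1, div_lt_one (by linarith)]
    linarith
  refine ⟨UnitDisc.mk _ h2, ?_, ?_⟩
  · rw [UnitDisc.coe_mk, time, h1]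
    field_simp
    ring
  · rw [UnitDisc.coe_mk, space, h1, ← mul_assoc, ← ofReal_mul]
    have : 2 / (1 - (t - 1) / (t + 1)) * (1 / (1 + t)) = 1 := by
      have h3 : 1 - (t - 1) / (t + 1) = 2 / (1 + t) := by field_simp; ring
      rw [h3]; field_simp
    rw [this, ofReal_one, one_mul]

theorem hdist_nonneg (z w : 𝔻) : 0 ≤ hdist z w := by
  rw [hdist]
  have : 0 ≤ ‖(z : ℂ) - w‖ / √((1 - ‖(z : ℂ)‖ ^ 2) * (1 - ‖(w : ℂ)‖ ^ 2)) := by positivity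
  have := Real.arsinh_nonneg_iff.2 this
  linarith

theorem cosh_hdist (z w : 𝔻) : Real.cosh (hdist z w) = coshDist z w := by
  rw [coshDist_eq z.normSq_lt_one w.normSq_lt_one, hdist, Real.cosh_two_mul, Real.cosh_sq,
    Real.sinh_arsinh, div_pow, Real.sq_sqrt, normSq_eq_norm_sq, normSq_eq_norm_sq,
    normSq_eq_norm_sq]
  · ring
  · have h1 := z.normSq_lt_one
    have h2 := w.normSq_lt_one
    rw [normSq_eq_norm_sq] at h1 h2
    exact mul_nonneg (by linarith) (by linarith)

theorem one_le_coshDist (z w : 𝔻) : 1 ≤ coshDist z w := by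
  rw [← cosh_hdist]
  exact Real.one_le_cosh _

theorem hdist_le_iff {z w : 𝔻} {r : ℝ} (hr : 0 ≤ r) :
    hdist z w ≤ r ↔ coshDist z w ≤ Real.cosh r := by
  rw [← cosh_hdist, Real.cosh_le_cosh, abs_of_nonneg hr, abs_of_nonneg (hdist_nonneg z w)]

theorem le_hdist_iff {z w : 𝔻} {r : ℝ} (hr : 0 ≤ r) :
    r ≤ hdist z w ↔ Real.cosh r ≤ coshDist z w := by
  rw [← cosh_hdist, Real.cosh_le_cosh, abs_of_nonneg hr, abs_of_nonneg (hdist_nonneg z w)]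

theorem hdist_eq_iff {z w z' w' : 𝔻} : hdist z w = hdist z' w' ↔ coshDist z w = coshDist z' w' := by
  refine ⟨fun h => by rw [← cosh_hdist, h, cosh_hdist], fun h => le_antisymm ?_ ?_⟩
  · rw [hdist_le_iff (hdist_nonneg _ _), cosh_hdist, h]
  · rw [hdist_le_iff (hdist_nonneg _ _), cosh_hdist, h]

/-! ### Segments and convex sets in the hyperboloid model. -/

theorem mem_hsegment_of_coord {x z w : 𝔻} {a b : ℝ} (ha : 0 ≤ a) (hb : 0 ≤ b)
    (ht : time x = a * time z + b * time w) (hu : space x = a * space z + b * space w) :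
    x ∈ hsegment z w := by
  have hre : (space (x : ℂ)).re = a * (space (z : ℂ)).re + b * (space (w : ℂ)).re := by
    rw [hu, add_re, re_ofReal_mul, re_ofReal_mul]
  have him : (space (x : ℂ)).im = a * (space (z : ℂ)).im + b * (space (w : ℂ)).im := by
    rw [hu, add_im, im_ofReal_mul, im_ofReal_mul]
  have hx := time_sq x
  have hz := time_sq z
  have hw := time_sq w
  have h1 : coshDist z x = a + b * coshDist z w := by
    simp only [coshDist, ht, hre, him]
    linear_combination a * hz
  have h2 : coshDist x w = a * coshDist z w + b := by
    simp only [coshDist, ht, hre, him]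
    linear_combination b * hw
  have h3 : a ^ 2 + b ^ 2 + 2 * a * b * coshDist z w = 1 := by
    rw [ht, hre, him] at hx
    simp only [coshDist]
    linear_combination hx - a ^ 2 * hz - b ^ 2 * hw
  have hs := Real.cosh_sq (hdist z w)
  have s0 : 0 ≤ Real.sinh (hdist z w) := Real.sinh_nonneg_iff.2 (hdist_nonneg _ _)
  rw [cosh_hdist] at hs
  -- The coefficients are ratios of hyperbolic sines of distances; the addition formula for `cosh`
  -- then adds up the two distances.
  have h4 : Real.sinh (hdist z x) = b * Real.sinh (hdist z w) := by
    apply (pow_left_inj₀ (Real.sinh_nonneg_iff.2 (hdist_nonneg _ _)) (mul_nonneg hb s0)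
      two_ne_zero).1
    have := Real.cosh_sq (hdist z x)
    rw [cosh_hdist, h1] at this
    linear_combination h3 - this + b ^ 2 * hs
  have h5 : Real.sinh (hdist x w) = a * Real.sinh (hdist z w) := by
    apply (pow_left_inj₀ (Real.sinh_nonneg_iff.2 (hdist_nonneg _ _)) (mul_nonneg ha s0)
      two_ne_zero).1
    have := Real.cosh_sq (hdist x w)
    rw [cosh_hdist, h2] at this
    linear_combination h3 - this + a ^ 2 * hs
  have h6 : Real.cosh (hdist z x + hdist x w) = Real.cosh (hdist z w) := by
    rw [Real.cosh_add, h4, h5, cosh_hdist, cosh_hdist, cosh_hdist, h1, h2]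
    linear_combination coshDist z w * h3 - a * b * hs
  have h7 := hdist_nonneg z x
  have h8 := hdist_nonneg x w
  have h9 := hdist_nonneg z w
  have h10 := le_antisymm (Real.cosh_le_cosh.1 h6.le) (Real.cosh_le_cosh.1 h6.ge)
  rwa [abs_of_nonneg (by linarith), abs_of_nonneg h9] at h10

theorem eq_of_hdist_eq_zero {z w : 𝔻} (h : hdist z w = 0) : z = w := by
  have h1 := cosh_hdist z w
  rw [h, Real.cosh_zero, coshDist_eq z.normSq_lt_one w.normSq_lt_one] at h1
  have hz : 0 < 1 - normSq (z : ℂ) := by linarith [z.normSq_lt_one]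
  have hw : 0 < 1 - normSq (w : ℂ) := by linarith [w.normSq_lt_one]
  have h2 : 2 * normSq ((z : ℂ) - w) / ((1 - normSq (z : ℂ)) * (1 - normSq (w : ℂ))) = 0 := by
    linarith
  rw [div_eq_zero_iff, or_iff_left (mul_pos hz hw).ne'] at h2
  have h3 : normSq ((z : ℂ) - w) = 0 := by linarith
  exact UnitDisc.coe_injective (sub_eq_zero.1 (normSq_eq_zero.1 h3))

/-- With `p`, `q`, `σ` the hyperbolic sines of the distances `zx`, `xw`, `zw`, the defect `q z + p w
- σ x` is Minkowski-orthogonal to the timelike vector `x` and also null. Only the zero vector is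
both. -/
theorem exists_coord_of_mem_hsegment {x z w : 𝔻} (h : x ∈ hsegment z w) :
    ∃ a b : ℝ, 0 ≤ a ∧ 0 ≤ b ∧ time x = a * time z + b * time w ∧
      (space (x : ℂ)).re = a * (space (z : ℂ)).re + b * (space (w : ℂ)).re ∧
      (space (x : ℂ)).im = a * (space (z : ℂ)).im + b * (space (w : ℂ)).im := by
  have h' : hdist z x + hdist x w = hdist z w := h
  rcases (hdist_nonneg z w).eq_or_lt with h0 | h0
  · have : x = z := by
      refine (eq_of_hdist_eq_zero ?_).symm
      linarith [hdist_nonneg z x, hdist_nonneg x w]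
    exact ⟨1, 0, by norm_num, le_rfl, by simp [this], by simp [this], by simp [this]⟩
  · have hs0 : 0 < Real.sinh (hdist z w) := Real.sinh_pos_iff.2 h0
    have sα := Real.sinh_nonneg_iff.2 (hdist_nonneg z x)
    have sβ := Real.sinh_nonneg_iff.2 (hdist_nonneg x w)
    have hα := Real.cosh_sq (hdist z x)
    have hβ := Real.cosh_sq (hdist x w)
    have hc : Real.cosh (hdist z w) = Real.cosh (hdist z x) * Real.cosh (hdist x w) +
        Real.sinh (hdist z x) * Real.sinh (hdist x w) := by rw [← h', Real.cosh_add]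
    have hs : Real.sinh (hdist z w) = Real.sinh (hdist z x) * Real.cosh (hdist x w) +
        Real.cosh (hdist z x) * Real.sinh (hdist x w) := by rw [← h', Real.sinh_add]
    rw [cosh_hdist, cosh_hdist, cosh_hdist] at hc
    rw [cosh_hdist, cosh_hdist] at hs
    rw [cosh_hdist] at hα hβ
    have hx := time_sq x
    have hz := time_sq z
    have hw := time_sq w
    set σ := Real.sinh (hdist z w)
    set p := Real.sinh (hdist z x)
    set q := Real.sinh (hdist x w)
    set yt := q * time z + p * time w - σ * time x with hyt
    set y1 := q * (space (z : ℂ)).re + p * (space (w : ℂ)).re - σ * (space (x : ℂ)).re with hy1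
    set y2 := q * (space (z : ℂ)).im + p * (space (w : ℂ)).im - σ * (space (x : ℂ)).im with hy2
    have e1 : yt * time x - y1 * (space (x : ℂ)).re - y2 * (space (x : ℂ)).im = 0 := by
      have : yt * time x - y1 * (space (x : ℂ)).re - y2 * (space (x : ℂ)).im =
          q * coshDist z x + p * coshDist x w - σ := by
        simp only [coshDist, hyt, hy1, hy2]
        linear_combination -σ * hx
      rw [this, hs]; ring
    have e2 : yt ^ 2 - y1 ^ 2 - y2 ^ 2 = 0 := by
      have : yt ^ 2 - y1 ^ 2 - y2 ^ 2 = q ^ 2 + p ^ 2 + σ ^ 2 + 2 * p * q * coshDist z w -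
          2 * q * σ * coshDist z x - 2 * p * σ * coshDist x w := by
        simp only [coshDist, hyt, hy1, hy2]
        linear_combination q ^ 2 * hz + p ^ 2 * hw + σ ^ 2 * hx
      rw [this, hc, hs]
      linear_combination -q ^ 2 * hα - p ^ 2 * hβ
    have e3 : (yt * time x) ^ 2 ≤ (y1 ^ 2 + y2 ^ 2) *
        ((space (x : ℂ)).re ^ 2 + (space (x : ℂ)).im ^ 2) := by
      have : yt * time x = y1 * (space (x : ℂ)).re + y2 * (space (x : ℂ)).im := by linarith
      rw [this]
      nlinarith [sq_nonneg (y1 * (space (x : ℂ)).im - y2 * (space (x : ℂ)).re)]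
    have e4 : yt ^ 2 = 0 := by
      have e5 : y1 ^ 2 + y2 ^ 2 = yt ^ 2 := by linarith
      rw [e5, mul_pow, hx] at e3
      exact le_antisymm (by linarith) (sq_nonneg _)
    have ft : yt = 0 := pow_eq_zero_iff two_ne_zero |>.1 e4
    have f1 : y1 = 0 := by
      apply pow_eq_zero_iff two_ne_zero |>.1
      linarith [sq_nonneg y1, sq_nonneg y2]
    have f2 : y2 = 0 := by
      apply pow_eq_zero_iff two_ne_zero |>.1
      linarith [sq_nonneg y1, sq_nonneg y2]
    refine ⟨q / σ, p / σ, by positivity, by positivity, ?_, ?_, ?_⟩ <;> field_simp <;> linarith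

/-- A half-plane, given by a linear inequality in the hyperboloid model, is convex. -/
theorem hconvex_halfPlane (l : ℝ) (n : ℂ) :
    HConvex {x : 𝔻 | 0 ≤ l * time x - n.re * (space x).re - n.im * (space (x : ℂ)).im} := by
  intro z hz w hw x hx
  obtain ⟨a, b, ha, hb, ht, h1, h2⟩ := exists_coord_of_mem_hsegment hx
  rw [Set.mem_ofPred_eq] at *
  rw [ht, h1, h2]
  have := mul_nonneg ha hz
  have := mul_nonneg hb hw
  linarith

/-- A closed disk is convex. -/
theorem hconvex_closedBall (c : 𝔻) (r : ℝ) : HConvex {x : 𝔻 | hdist c x ≤ r} := by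
  intro z hz w hw x hx
  obtain ⟨a, b, ha, hb, ht, h1, h2⟩ := exists_coord_of_mem_hsegment hx
  have hr : 0 ≤ r := (hdist_nonneg _ _).trans hz
  rw [Set.mem_ofPred_eq, hdist_le_iff hr] at *
  have e : coshDist c x = a * coshDist c z + b * coshDist c w := by
    simp only [coshDist, ht, h1, h2]; ring
  -- `x` has Minkowski norm one, so `a² + b² + 2ab cosh d = 1` with `cosh d ≥ 1`.
  have hab : a + b ≤ 1 := by
    have hx := time_sq x
    rw [ht, h1, h2] at hx
    have h3 : a ^ 2 + b ^ 2 + 2 * a * b * coshDist z w = 1 := by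
      simp only [coshDist]
      linear_combination hx - a ^ 2 * time_sq z - b ^ 2 * time_sq w
    have h4 := mul_le_mul_of_nonneg_left (one_le_coshDist z w) (mul_nonneg ha hb)
    have h5 : (a + b) ^ 2 ≤ 1 ^ 2 := by nlinarith
    exact le_of_sq_le_sq h5 one_pos.le
  have h6 := mul_le_mul_of_nonneg_left hz ha
  have h7 := mul_le_mul_of_nonneg_left hw hb
  have h8 := mul_le_mul_of_nonneg_right hab (Real.cosh_pos r).le
  rw [e]
  linarith

theorem subset_hconvexHull (S : Set 𝔻) : S ⊆ hconvexHull S :=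
  Set.subset_sInter fun _ h => h.2

theorem hconvexHull_subset {S C : Set 𝔻} (hC : HConvex C) (h : S ⊆ C) : hconvexHull S ⊆ C :=
  Set.sInter_subset_of_mem ⟨hC, h⟩

theorem hconvex_hconvexHull (S : Set 𝔻) : HConvex (hconvexHull S) := by
  intro z hz w hw x hx C hC
  exact hC.1 z (hz C hC) w (hw C hC) hx

/-- If the centre of a disk is on the positive side of a line, at distance greater than the
radius, then the whole disk is on the positive side. Here `l ^ 2 + s ^ 2 = ‖n‖ ^ 2`. -/
theorem disk_subset_halfPlane {c x : 𝔻} {k l s : ℝ} {n : ℂ}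
    (hn : l ^ 2 + s ^ 2 = n.re ^ 2 + n.im ^ 2)
    (h0 : 0 < l * time c - n.re * (space c).re - n.im * (space (c : ℂ)).im)
    (hk : k ^ 2 * s ^ 2 <
      (l * time c - n.re * (space c).re - n.im * (space (c : ℂ)).im) ^ 2 + s ^ 2)
    (hx : coshDist c x ≤ k) :
    0 < l * time x - n.re * (space x).re - n.im * (space (x : ℂ)).im := by
  by_contra! hneg
  set v := l * time x - n.re * (space x).re - n.im * (space (x : ℂ)).im with hv
  set u := l * time c - n.re * (space c).re - n.im * (space (c : ℂ)).im with hu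
  have hK := one_le_coshDist c x
  have hc := time_sq c
  have hx2 := time_sq x
  set K := coshDist c x with hKdef
  -- The left side is the Gram determinant of `c`, `x` and the normal of the line; in this signature
  -- it is the square of their determinant. For `v ≤ 0` its positivity forces `s² K² ≥ s² + u²`,
  -- against `hk`.
  have gram : s ^ 2 * K ^ 2 + 2 * K * u * v - s ^ 2 - v ^ 2 - u ^ 2 =
      (l * ((space c).re * (space (x : ℂ)).im - (space (c : ℂ)).im * (space x).re)
        - n.re * (time c * (space (x : ℂ)).im - (space (c : ℂ)).im * time x)
        + n.im * (time c * (space (x : ℂ)).re - (space (c : ℂ)).re * time x)) ^ 2 := by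
    have hcc : time c ^ 2 - (space (c : ℂ)).re ^ 2 - (space (c : ℂ)).im ^ 2 = 1 := by linarith
    have hxx : time x ^ 2 - (space (x : ℂ)).re ^ 2 - (space (x : ℂ)).im ^ 2 = 1 := by linarith
    have hnn : l ^ 2 - n.re ^ 2 - n.im ^ 2 = -s ^ 2 := by linarith
    calc _ = 1 * 1 * (-s ^ 2) - 1 * v ^ 2 - K ^ 2 * (-s ^ 2) + 2 * K * u * v - u ^ 2 * 1 := by ring
      _ = (time c ^ 2 - (space (c : ℂ)).re ^ 2 - (space (c : ℂ)).im ^ 2) *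
          (time x ^ 2 - (space (x : ℂ)).re ^ 2 - (space (x : ℂ)).im ^ 2) *
          (l ^ 2 - n.re ^ 2 - n.im ^ 2) -
          (time c ^ 2 - (space (c : ℂ)).re ^ 2 - (space (c : ℂ)).im ^ 2) * v ^ 2 -
          K ^ 2 * (l ^ 2 - n.re ^ 2 - n.im ^ 2) + 2 * K * u * v -
          u ^ 2 * (time x ^ 2 - (space (x : ℂ)).re ^ 2 - (space (x : ℂ)).im ^ 2) := by
        rw [hcc, hxx, hnn]
      _ = _ := by
        simp only [hKdef, hu, hv, coshDist]
        ring
  have h1 : 0 ≤ s ^ 2 * K ^ 2 + 2 * K * u * v - s ^ 2 - v ^ 2 - u ^ 2 := by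
    rw [gram]; positivity
  have h2 : K * u * v ≤ 0 := mul_nonpos_of_nonneg_of_nonpos (by positivity) hneg
  have h3 : K ^ 2 ≤ k ^ 2 := pow_le_pow_left₀ (by linarith) hx 2
  have h4 := mul_le_mul_of_nonneg_right h3 (sq_nonneg s)
  linarith [sq_nonneg v]

/-! ### The regular polygon -/

/-- Half of the angle at which a side of the polygon is seen from the centre. -/
def ang (g : ℕ) : ℝ := Real.pi / (4 * g)

/-- The Euclidean norm of the vertices of the polygon. -/
def rad (g : ℕ) : ℝ := √(Real.cos (Real.pi / (2 * g)))

theorem ang_pos {g : ℕ} (hg : 2 ≤ g) : 0 < ang g := by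
  have : (2 : ℝ) ≤ g := by exact_mod_cast hg
  have := Real.pi_pos
  rw [ang]; positivity

theorem ang_le {g : ℕ} (hg : 2 ≤ g) : ang g ≤ Real.pi / 8 := by
  have : (2 : ℝ) ≤ g := by exact_mod_cast hg
  exact div_le_div_of_nonneg_left Real.pi_pos.le (by norm_num) (by linarith)

theorem ang_mul {g : ℕ} (hg : 2 ≤ g) : 4 * g * ang g = Real.pi := by
  have : (2 : ℝ) ≤ g := by exact_mod_cast hg
  rw [ang]; field_simp

theorem sin_ang_pos {g : ℕ} (hg : 2 ≤ g) : 0 < Real.sin (ang g) :=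
  Real.sin_pos_of_pos_of_lt_pi (ang_pos hg) (by linarith [ang_le hg, Real.pi_pos])

theorem cos_ang_pos {g : ℕ} (hg : 2 ≤ g) : 0 < Real.cos (ang g) :=
  Real.cos_pos_of_mem_Ioo
    ⟨by linarith [ang_pos hg, Real.pi_pos], by linarith [ang_le hg, Real.pi_pos]⟩

theorem cos_two_ang_pos {g : ℕ} (hg : 2 ≤ g) : 0 < Real.cos (2 * ang g) :=
  Real.cos_pos_of_mem_Ioo
    ⟨by linarith [ang_pos hg, Real.pi_pos], by linarith [ang_le hg, Real.pi_pos]⟩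

theorem two_mul_ang (g : ℕ) : 2 * ang g = Real.pi / (2 * g) := by
  rw [ang]; ring

theorem rad_pos {g : ℕ} (hg : 2 ≤ g) : 0 < rad g := by
  rw [rad, ← two_mul_ang]
  exact Real.sqrt_pos.2 (cos_two_ang_pos hg)

theorem rad_sq {g : ℕ} (hg : 2 ≤ g) : rad g ^ 2 = Real.cos (2 * ang g) := by
  rw [rad, ← two_mul_ang]
  exact Real.sq_sqrt (cos_two_ang_pos hg).le

theorem rad_sq' {g : ℕ} (hg : 2 ≤ g) :
    rad g ^ 2 = Real.cos (ang g) ^ 2 - Real.sin (ang g) ^ 2 := by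
  rw [rad_sq hg, Real.cos_two_mul']

/-! ### Directions and sectors. -/

/-- The unit complex number with argument `θ`. -/
def dir (θ : ℝ) : ℂ := exp (θ * I)

@[simp] theorem dir_re (θ : ℝ) : (dir θ).re = Real.cos θ := exp_ofReal_mul_I_re θ

@[simp] theorem dir_im (θ : ℝ) : (dir θ).im = Real.sin θ := exp_ofReal_mul_I_im θ

theorem dir_add (a b : ℝ) : dir (a + b) = dir a * dir b := by
  rw [dir, dir, dir, ← exp_add]
  congr 1; push_cast; ring

@[simp] theorem dir_zero : dir 0 = 1 := by simp [dir]

theorem conj_dir (a : ℝ) : conj (dir a) = dir (-a) := by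
  apply Complex.ext <;> simp

theorem dir_mul_conj (a b : ℝ) : dir a * conj (dir b) = dir (a - b) := by
  rw [conj_dir, ← dir_add, sub_eq_add_neg]

theorem dir_mul_conj_self (a : ℝ) : dir a * conj (dir a) = 1 := by
  rw [dir_mul_conj, sub_self, dir_zero]

theorem norm_dir (a : ℝ) : ‖dir a‖ = 1 := norm_exp_ofReal_mul_I a

theorem normSq_dir (a : ℝ) : normSq (dir a) = 1 := by
  rw [normSq_eq_norm_sq, norm_dir, one_pow]

theorem dir_add_pi (a : ℝ) : dir (a + Real.pi) = -dir a := by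
  apply Complex.ext <;> simp [Real.cos_add_pi, Real.sin_add_pi]

theorem dir_add_int_mul_two_pi (a : ℝ) (n : ℤ) : dir (a + n * (2 * Real.pi)) = dir a := by
  apply Complex.ext <;> simp [Real.cos_add_int_mul_two_pi, Real.sin_add_int_mul_two_pi]

theorem norm_mul_dir_arg (w : ℂ) : (‖w‖ : ℂ) * dir (arg w) = w := norm_mul_exp_arg_mul_I w

/-- Every complex number lies in one of the sectors of angle `2 * ang g`. -/
theorem exists_sector {g : ℕ} (hg : 2 ≤ g) (w : ℂ) {δ : ℝ} (hδ : |δ| ≤ ang g) :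
    ∃ (j : ℕ) (θ : ℝ), |θ| ≤ ang g ∧ w = ‖w‖ * dir (2 * j * ang g + δ + θ) := by
  have hA := ang_pos hg
  have hA8 := ang_le hg
  have hpi := Real.pi_pos
  have hδ' := abs_le.1 hδ
  -- The summand `2π` makes the rounded index nonnegative, so that it is a natural number.
  set y := (arg w + 2 * Real.pi - δ) / (2 * ang g) with hy
  have hy0 : 0 ≤ y := by
    have := neg_pi_lt_arg w
    apply div_nonneg <;> linarith
  have hr : 0 ≤ round y := by
    have h1 := abs_le.1 (abs_sub_round y)
    have h2 : (-1 : ℝ) < round y := by linarith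
    have h3 : -1 < round y := by exact_mod_cast h2
    omega
  obtain ⟨j, hj⟩ := Int.eq_ofNat_of_zero_le hr
  refine ⟨j, arg w + 2 * Real.pi - δ - 2 * j * ang g, ?_, ?_⟩
  · have h1 := abs_sub_round y
    rw [hj] at h1
    have e : arg w + 2 * Real.pi - δ - 2 * j * ang g = (y - (j : ℤ)) * (2 * ang g) := by
      rw [hy, sub_mul, div_mul_cancel₀ _ (by linarith)]; push_cast; ring
    rw [e, abs_mul, abs_of_pos (by linarith : 0 < 2 * ang g)]
    have := mul_le_mul_of_nonneg_right h1 (by linarith : 0 ≤ 2 * ang g)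
    linarith
  · have e : 2 * j * ang g + δ + (arg w + 2 * Real.pi - δ - 2 * j * ang g) =
        arg w + (1 : ℤ) * (2 * Real.pi) := by push_cast; ring
    rw [e, dir_add_int_mul_two_pi, norm_mul_dir_arg]

/-- The direction of the midpoint of the side `s_j`. -/
def sideDir (g : ℕ) (j : ℤ) : ℂ := dir (2 * j * ang g)

/-- The direction of the vertex `v_j`. -/
def vertexDir (g : ℕ) (j : ℤ) : ℂ := dir ((2 * j - 1) * ang g)

theorem sideDir_add {g : ℕ} (hg : 2 ≤ g) (j n : ℤ) : sideDir g (j + n * (4 * g)) = sideDir g j := by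
  rw [sideDir, sideDir, ← dir_add_int_mul_two_pi (2 * j * ang g) n, ← ang_mul hg]
  congr 1; push_cast; ring

theorem vertexDir_add {g : ℕ} (hg : 2 ≤ g) (j n : ℤ) :
    vertexDir g (j + n * (4 * g)) = vertexDir g j := by
  rw [vertexDir, vertexDir, ← dir_add_int_mul_two_pi ((2 * j - 1) * ang g) n, ← ang_mul hg]
  congr 1; push_cast; ring

theorem coe_vertex {g : ℕ} (hg : 2 ≤ g) (j : ℕ) :
    (vertex g hg j : ℂ) = (rad g : ℂ) * vertexDir g j := by
  rw [vertex, UnitDisc.coe_mk, rad, vertexDir, dir, ang]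
  congr 2; push_cast; ring

theorem normSq_vertex {g : ℕ} (hg : 2 ≤ g) (j : ℕ) :
    normSq (vertex g hg j : ℂ) = rad g ^ 2 := by
  rw [coe_vertex, normSq_mul, normSq_ofReal, vertexDir, normSq_dir]; ring

theorem one_sub_rad_sq {g : ℕ} (hg : 2 ≤ g) : 1 - rad g ^ 2 = 2 * Real.sin (ang g) ^ 2 := by
  rw [rad_sq' hg, Real.sin_sq]; ring

theorem one_add_rad_sq {g : ℕ} (hg : 2 ≤ g) : 1 + rad g ^ 2 = 2 * Real.cos (ang g) ^ 2 := by
  rw [rad_sq' hg, Real.sin_sq]; ring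

theorem time_vertex {g : ℕ} (hg : 2 ≤ g) (j : ℕ) :
    time (vertex g hg j) = Real.cos (ang g) ^ 2 / Real.sin (ang g) ^ 2 := by
  have := (sin_ang_pos hg).ne'
  rw [time, normSq_vertex, one_sub_rad_sq hg, one_add_rad_sq hg]
  field_simp

theorem space_vertex {g : ℕ} (hg : 2 ≤ g) (j : ℕ) :
    space (vertex g hg j) = ((rad g / Real.sin (ang g) ^ 2 : ℝ) : ℂ) * vertexDir g j := by
  have := (sin_ang_pos hg).ne'
  rw [space, normSq_vertex, one_sub_rad_sq hg, coe_vertex, ← mul_assoc, ← ofReal_mul]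
  congr 2
  field_simp

theorem vertex_add {g : ℕ} (hg : 2 ≤ g) (j n : ℕ) : vertex g hg (j + n * (4 * g)) = vertex g hg j := by
  apply UnitDisc.coe_injective
  rw [coe_vertex, coe_vertex]
  have := vertexDir_add hg j n
  push_cast at this ⊢
  rw [this]

theorem vertex_mem_polygon {g : ℕ} (hg : 2 ≤ g) (j : ℕ) : vertex g hg j ∈ polygon g hg := by
  rw [← Nat.mod_add_div' j (4 * g), vertex_add]
  exact subset_hconvexHull _ ⟨_, Nat.mod_lt _ (by omega), rfl⟩

/-! ### The polygon as an intersection of half-planes. -/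

/-- The linear form in the hyperboloid model which vanishes on the line that contains the side with
midpoint in direction `u`, and is positive at the centre of the polygon. -/
def sideForm (g : ℕ) (u z : ℂ) : ℝ :=
  rad g * time z - Real.cos (ang g) * (space z * conj u).re

theorem sideForm_eq (g : ℕ) (u z : ℂ) :
    sideForm g u z = rad g * time z - ((Real.cos (ang g) : ℂ) * u).re * (space z).re -
      ((Real.cos (ang g) : ℂ) * u).im * (space z).im := by
  simp only [sideForm, mul_re, conj_re, conj_im, mul_im, ofReal_re, ofReal_im]
  ring

/-- Half-planes are convex, so only the vertices need checking; their directions differ from those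
of the side midpoints by odd multiples of `A`. -/
theorem sideForm_nonneg_of_mem_polygon {g : ℕ} (hg : 2 ≤ g) {z : 𝔻} (hz : z ∈ polygon g hg)
    (j : ℤ) : 0 ≤ sideForm g (sideDir g j) z := by
  have hC := hconvex_halfPlane (rad g) ((Real.cos (ang g) : ℂ) * sideDir g j)
  simp only [← sideForm_eq] at hC
  refine hconvexHull_subset hC ?_ hz
  rintro _ ⟨i, -, rfl⟩
  rw [Set.mem_ofPred_eq, sideForm, time_vertex, space_vertex, mul_assoc, re_ofReal_mul,
    vertexDir, sideDir, dir_mul_conj, dir_re]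
  have h := cos_odd_mul_le hg (i - j - 1)
  have e : (2 * ((i - j - 1 : ℤ) : ℝ) + 1) * (Real.pi / (4 * g)) =
      (2 * ((i : ℤ) : ℝ) - 1) * ang g - 2 * j * ang g := by
    rw [ang]; push_cast; ring
  rw [e, ← ang] at h
  have hs := sin_ang_pos hg
  have hc := cos_ang_pos hg
  have hR := rad_pos hg
  have h2 := mul_le_mul_of_nonneg_left h
    (by positivity : 0 ≤ Real.cos (ang g) * (rad g / Real.sin (ang g) ^ 2))
  have e2 : rad g * (Real.cos (ang g) ^ 2 / Real.sin (ang g) ^ 2) =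
    Real.cos (ang g) * (rad g / Real.sin (ang g) ^ 2) * Real.cos (ang g) := by ring
  rw [e2]
  linarith

@[simp] theorem time_zero : time 0 = 1 := by simp [time]

@[simp] theorem space_zero : space 0 = 0 := by simp [space]

/-- The vertices `v_0` and `v_{2g}` are antipodal. -/
theorem zero_mem_polygon {g : ℕ} (hg : 2 ≤ g) : (0 : 𝔻) ∈ polygon g hg := by
  have hs := sin_ang_pos hg
  have hc := cos_ang_pos hg
  refine hconvex_hconvexHull _ _ (vertex_mem_polygon hg 0) _ (vertex_mem_polygon hg (2 * g)) ?_
  have h : vertexDir g (2 * g : ℕ) = -vertexDir g (0 : ℕ) := by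
    rw [vertexDir, vertexDir, ← dir_add_pi, ← ang_mul hg]
    congr 1; push_cast; ring
  refine mem_hsegment_of_coord
    (a := Real.sin (ang g) ^ 2 / (2 * Real.cos (ang g) ^ 2))
    (b := Real.sin (ang g) ^ 2 / (2 * Real.cos (ang g) ^ 2)) (by positivity) (by positivity) ?_ ?_
  · rw [time_vertex, time_vertex, UnitDisc.coe_zero, time_zero]
    field_simp
    norm_num
  · rw [space_vertex, space_vertex, UnitDisc.coe_zero, space_zero, h]
    ring

theorem time_sq_norm (z : 𝔻) : time z ^ 2 = 1 + ‖space (z : ℂ)‖ ^ 2 := by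
  rw [time_sq, ← normSq_eq_norm_sq, normSq_apply]; ring

/-- A convex set which contains `0`, `z` and `w` contains the points of the cone over them. -/
theorem HConvex.mem_of_cone {S : Set 𝔻} (hS : HConvex S) {x z w : 𝔻} (h0 : (0 : 𝔻) ∈ S)
    (hz : z ∈ S) (hw : w ∈ S) {α β γ : ℝ} (hα : 0 ≤ α) (hβ : 0 ≤ β) (hγ : 0 ≤ γ)
    (ht : time x = α + β * time z + γ * time w) (hu : space x = β * space z + γ * space w) :
    x ∈ S := by
  have h1 := one_le_coshDist z w
  set N := β ^ 2 + γ ^ 2 + 2 * β * γ * coshDist z w with hN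
  have hβγ : 0 ≤ β * γ := mul_nonneg hβ hγ
  have hNge : (β + γ) ^ 2 ≤ N := by
    have := mul_le_mul_of_nonneg_left h1 hβγ
    rw [hN]; linarith
  rcases (add_nonneg hβ hγ).eq_or_lt with h | h
  · have e1 : β = 0 := by linarith
    have e2 : γ = 0 := by linarith
    have hu0 : space x = 0 := by rw [hu, e1, e2]; simp
    have : (x : ℂ) = 0 := by rw [space_div, hu0, mul_zero]
    rwa [UnitDisc.coe_eq_zero.1 this]
  · have hN0 : 0 < N := (pow_pos h 2).trans_le hNge
    have hsq := Real.sq_sqrt hN0.le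
    have hs0 : 0 < √N := Real.sqrt_pos.2 hN0
    have htp : 0 < β * time z + γ * time w := by
      rcases hβ.eq_or_lt with e | e
      · rw [← e] at h ⊢
        have := mul_pos (by linarith : 0 < γ) (time_pos w)
        linarith
      · have := mul_pos e (time_pos z)
        have := mul_nonneg hγ (time_pos w).le
        linarith
    -- `√N` is the Minkowski norm of `β z + γ w`; dividing by it gives a point `y` of `[z, w]`, and
    -- `x` lies on `[0, y]`.
    obtain ⟨y, hyt, hyu⟩ := exists_coord (t := (β * time z + γ * time w) / √N)
      (u := ((1 / √N : ℝ) : ℂ) * (β * space z + γ * space w)) (by positivity) (by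
        simp only [re_ofReal_mul, im_ofReal_mul, add_re, add_im]
        field_simp
        rw [hsq, hN, coshDist]
        linear_combination β ^ 2 * time_sq z + γ ^ 2 * time_sq w)
    have hy : y ∈ S := by
      refine hS z hz w hw (mem_hsegment_of_coord (a := β / √N) (b := γ / √N) (by positivity)
        (by positivity) ?_ ?_)
      · rw [hyt]; ring
      · rw [hyu]; push_cast; ring
    refine hS 0 h0 y hy (mem_hsegment_of_coord (a := α) (b := √N) hα hs0.le ?_ ?_)
    · rw [ht, hyt, UnitDisc.coe_zero, time_zero]; field_simp; ring
    · rw [hu, hyu, UnitDisc.coe_zero, space_zero, ← mul_assoc, ← ofReal_mul,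
        mul_one_div_cancel hs0.ne']
      simp

/-- Only the side of the sector containing `z` matters: `z` is in the cone over `0`, `v_j`,
`v_{j+1}`. The coefficient of `0` is the side form divided by `rad g`, and those of the vertices are
nonnegative because `|θ| ≤ A`. -/
theorem mem_polygon_of_sideForm_nonneg {g : ℕ} (hg : 2 ≤ g) {z : 𝔻}
    (h : ∀ j : ℤ, 0 ≤ sideForm g (sideDir g j) z) : z ∈ polygon g hg := by
  have hs := sin_ang_pos hg
  have hc := cos_ang_pos hg
  have hR := rad_pos hg
  have hA := ang_pos hg
  have hA8 := ang_le hg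
  have hpi := Real.pi_pos
  obtain ⟨j, θ, hθ, hw⟩ := exists_sector hg (space z) (δ := 0) (by simpa using hA.le)
  rw [add_zero] at hw
  have hθ' := abs_le.1 hθ
  set ρ := ‖space (z : ℂ)‖
  have hρ : 0 ≤ ρ := norm_nonneg _
  have h1 := h j
  have e1 : (space (z : ℂ) * conj (sideDir g j)).re = ρ * Real.cos θ := by
    rw [hw, sideDir, mul_assoc, dir_mul_conj, re_ofReal_mul, dir_re]
    congr 2; push_cast; ring
  rw [sideForm, e1] at h1
  have hp : 0 ≤ Real.cos θ * Real.sin (ang g) + Real.sin θ * Real.cos (ang g) := by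
    rw [add_comm, ← Real.sin_add]
    exact Real.sin_nonneg_of_nonneg_of_le_pi (by linarith) (by linarith)
  have hm : 0 ≤ Real.cos θ * Real.sin (ang g) - Real.sin θ * Real.cos (ang g) := by
    have : 0 ≤ Real.sin (ang g - θ) :=
      Real.sin_nonneg_of_nonneg_of_le_pi (by linarith) (by linarith)
    rw [Real.sin_sub] at this
    linarith
  set s := Real.sin (ang g)
  set c := Real.cos (ang g)
  have hone : s ^ 2 + c ^ 2 = 1 := Real.sin_sq_add_cos_sq (ang g)
  refine HConvex.mem_of_cone (hconvex_hconvexHull _) (zero_mem_polygon hg)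
    (vertex_mem_polygon hg j) (vertex_mem_polygon hg (j + 1))
    (α := (rad g * time z - c * (ρ * Real.cos θ)) / rad g)
    (β := ρ * s / (2 * rad g * c) * (Real.cos θ * s - Real.sin θ * c))
    (γ := ρ * s / (2 * rad g * c) * (Real.cos θ * s + Real.sin θ * c))
    (by positivity) (mul_nonneg (by positivity) hm) (mul_nonneg (by positivity) hp) ?_ ?_
  · rw [time_vertex, time_vertex]
    change time z = _ + _ * (c ^ 2 / s ^ 2) + _ * (c ^ 2 / s ^ 2)
    field_simp
    ring
  · have d1 : vertexDir g j = dir (2 * j * ang g) * dir (-ang g) := by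
      rw [vertexDir, ← dir_add]; congr 1; push_cast; ring
    have d2 : vertexDir g (j + 1 : ℕ) = dir (2 * j * ang g) * dir (ang g) := by
      rw [vertexDir, ← dir_add]; congr 1; push_cast; ring
    have d3 : (ρ : ℂ) * dir θ = ((ρ * s / (2 * rad g * c) * (Real.cos θ * s - Real.sin θ * c) *
        (rad g / s ^ 2) : ℝ) : ℂ) * dir (-ang g) +
        ((ρ * s / (2 * rad g * c) * (Real.cos θ * s + Real.sin θ * c) *
        (rad g / s ^ 2) : ℝ) : ℂ) * dir (ang g) := by
      apply Complex.ext
      · simp only [add_re, re_ofReal_mul, dir_re, Real.cos_neg]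
        change _ = _ * c + _ * c
        field_simp
        ring
      · simp only [add_im, im_ofReal_mul, dir_im, Real.sin_neg]
        change _ = _ * -s + _ * s
        field_simp
        ring
    rw [space_vertex, space_vertex, d1, d2, hw, dir_add]
    calc (ρ : ℂ) * (dir (2 * j * ang g) * dir θ) = dir (2 * j * ang g) * (ρ * dir θ) := by ring
      _ = _ := by rw [d3]; simp only [ofReal_mul]; ring

theorem originalDomain_subset_polygon {g : ℕ} (hg : 2 ≤ g) :
    originalDomain g hg ⊆ polygon g hg := by
  rintro z ((h | h) | ⟨j, -, -, h, -⟩)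
  · exact interior_subset h
  · rw [Set.mem_singleton_iff.1 h]
    exact vertex_mem_polygon hg 0
  · exact hconvex_hconvexHull _ _ (vertex_mem_polygon hg j) _ (vertex_mem_polygon hg (j + 1)) h

/-- The midpoint of the side `s_j`. -/
theorem exists_midpoint {g : ℕ} (hg : 2 ≤ g) (j : ℕ) :
    ∃ m : 𝔻, time m = Real.cos (ang g) / Real.sin (ang g) ∧
      space m = ((rad g / Real.sin (ang g) : ℝ) : ℂ) * sideDir g j ∧ m ∈ side g hg j ∧
      hdist (vertex g hg j) m = hdist m (vertex g hg (j + 1)) := by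
  have hs := sin_ang_pos hg
  have hc := cos_ang_pos hg
  have d1 : vertexDir g j = dir (2 * j * ang g) * dir (-ang g) := by
    rw [vertexDir, ← dir_add]; congr 1; push_cast; ring
  have d2 : vertexDir g (j + 1 : ℕ) = dir (2 * j * ang g) * dir (ang g) := by
    rw [vertexDir, ← dir_add]; congr 1; push_cast; ring
  have hsum : dir (-ang g) + dir (ang g) = ((2 * Real.cos (ang g) : ℝ) : ℂ) := by
    apply Complex.ext
    · rw [ofReal_re]; simp; ring
    · rw [ofReal_im]; simp
  have d0 : sideDir g j = dir (2 * j * ang g) := by rw [sideDir]; push_cast; rfl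
  have hn := normSq_dir (2 * j * ang g)
  rw [normSq_apply] at hn
  obtain ⟨m, ht, hu⟩ := exists_coord (t := Real.cos (ang g) / Real.sin (ang g))
    (u := ((rad g / Real.sin (ang g) : ℝ) : ℂ) * sideDir g j) (by positivity) (by
      rw [d0, re_ofReal_mul, im_ofReal_mul]
      field_simp
      linear_combination (-rad g ^ 2) * hn - rad_sq' hg)
  refine ⟨m, ht, hu, ?_, ?_⟩
  · refine mem_hsegment_of_coord (a := Real.sin (ang g) / (2 * Real.cos (ang g)))
      (b := Real.sin (ang g) / (2 * Real.cos (ang g))) (by positivity) (by positivity) ?_ ?_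
    · rw [time_vertex, time_vertex, ht]; field_simp; ring
    · rw [space_vertex, space_vertex, hu, d0, d1, d2, ← mul_add, ← mul_add, ← mul_add, hsum,
        mul_comm (dir _) (ofReal _), ← mul_assoc, ← mul_assoc, ← ofReal_mul, ← ofReal_mul]
      congr 2
      field_simp
  · rw [hdist_eq_iff, coshDist_comm]
    simp only [coshDist, time_vertex, space_vertex, hu, d0, d1, d2, mul_re, mul_im, ofReal_re,
      ofReal_im, dir_re, dir_im, Real.cos_neg, Real.sin_neg]
    ring

/-! ### Empty disks -/

/-- The disk with centre `C` and radius `r`, where `k = cosh r`, contains neither the centre of the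
polygon nor the midpoint of a side in its interior. -/
def IsClear (g : ℕ) (k : ℝ) (C : ℂ) : Prop :=
  k ≤ time C ∧ ∀ j : ℤ, k * Real.sin (ang g) ≤
    Real.cos (ang g) * time C - rad g * (space C * conj (sideDir g j)).re

theorem norm_sideDir (g : ℕ) (j : ℤ) : ‖sideDir g j‖ = 1 := norm_dir _

theorem norm_vertexDir (g : ℕ) (j : ℤ) : ‖vertexDir g j‖ = 1 := norm_dir _

/-- `θ` is the angle from `w` to the nearest side direction `i`. If `i` is adjacent to `j`, then `w`
lies beyond it, at angle `2A + θ` from `j`; otherwise the angle is at least `4A - θ ≥ 2A + θ`. -/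
theorem exists_near_sideDir {g : ℕ} (hg : 2 ≤ g) (w : ℂ) (j : ℤ)
    (h : (w * conj (sideDir g j)).re ≤ ‖w‖ * Real.cos (2 * ang g)) :
    ∃ (θ q : ℝ) (i : ℤ), 0 ≤ θ ∧ θ ≤ ang g ∧ (w * conj (sideDir g j)).re = ‖w‖ * q ∧
      q ≤ Real.cos (2 * ang g + θ) ∧ (w * conj (sideDir g i)).re = ‖w‖ * Real.cos θ := by
  have hA := ang_pos hg
  have hA8 := ang_le hg
  have hpi := Real.pi_pos
  rcases (norm_nonneg w).eq_or_lt with h0 | h0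
  -- For `w = 0` any `q` satisfies the equation, and `-1` is below every cosine.
  · refine ⟨0, -1, 0, le_rfl, hA.le, ?_, Real.neg_one_le_cos _, ?_⟩ <;>
    simp [norm_eq_zero.1 h0.symm]
  · set v := w * conj (sideDir g j) with hv
    have hnorm : ‖v‖ = ‖w‖ := by rw [hv, norm_mul, norm_conj, norm_sideDir, mul_one]
    have hvarg := norm_mul_dir_arg v
    set α := arg v with hα
    have hre : v.re = ‖w‖ * Real.cos α := by rw [← hvarg, re_ofReal_mul, dir_re, hnorm]
    rw [hre] at h
    have hcos := le_of_mul_le_mul_left h h0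
    have hαπ : |α| ≤ Real.pi := abs_arg_le_pi v
    have hα2 : 2 * ang g ≤ |α| := by
      by_contra! hlt
      have := Real.cos_lt_cos_of_nonneg_of_le_pi (abs_nonneg α) (by linarith) hlt
      rw [Real.cos_abs] at this
      linarith
    set n := round (α / (2 * ang g)) with hn
    have hr := abs_sub_round (α / (2 * ang g))
    rw [← hn] at hr
    set t := α - 2 * n * ang g with ht
    have htA : |t| ≤ ang g := by
      have e : t = (α / (2 * ang g) - n) * (2 * ang g) := by
        rw [ht]; field_simp
      rw [e, abs_mul, abs_of_pos (by linarith : 0 < 2 * ang g)]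
      have := mul_le_mul_of_nonneg_right hr (by linarith : 0 ≤ 2 * ang g)
      linarith
    have hle : 2 * ang g + |t| ≤ |α| := by
      have hα' : α = 2 * n * ang g + t := by rw [ht]; ring
      have ht' := abs_le.1 htA
      rcases lt_trichotomy n 0 with hn0 | hn0 | hn0
      · rcases (by omega : n = -1 ∨ n ≤ -2) with e | e
        · rw [e] at hα'
          push_cast at hα'
          rw [abs_of_neg (by linarith : α < 0)] at hα2 ⊢
          rw [abs_of_nonpos (by linarith : t ≤ 0)]
          linarith
        · have : (n : ℝ) ≤ -2 := by exact_mod_cast e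
          have h2 := mul_le_mul_of_nonneg_right this hA.le
          have := neg_abs_le α
          linarith
      · rw [hn0] at hα'
        push_cast at hα'
        rw [hα', mul_zero, zero_mul, zero_add] at hα2
        linarith
      · rcases (by omega : n = 1 ∨ 2 ≤ n) with e | e
        · rw [e] at hα'
          push_cast at hα'
          rw [abs_of_pos (by linarith : 0 < α)] at hα2 ⊢
          rw [abs_of_nonneg (by linarith : 0 ≤ t)]
          linarith
        · have : (2 : ℝ) ≤ n := by exact_mod_cast e
          have h2 := mul_le_mul_of_nonneg_right this hA.le
          have := le_abs_self α
          linarith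
    refine ⟨|t|, Real.cos α, j + n, abs_nonneg _, htA, hre, ?_, ?_⟩
    · rw [← Real.cos_abs α]
      exact Real.cos_le_cos_of_nonneg_of_le_pi (by positivity) hαπ hle
    · have e : w * conj (sideDir g (j + n)) = ‖w‖ * dir t := by
        have e1 : sideDir g (j + n) = sideDir g j * dir (2 * n * ang g) := by
          rw [sideDir, sideDir, ← dir_add]; congr 1; push_cast; ring
        rw [e1, map_mul, ← mul_assoc, ← hv, ← hvarg, hnorm, mul_assoc, dir_mul_conj]
      rw [e, re_ofReal_mul, dir_re, Real.cos_abs]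

/-- Used in both directions: it keeps a disk inside the sides not adjacent to its vertex, and, by
contraposition, it locates the centre of a disk that reaches a given side line. -/
theorem sideForm_pos_of_isClear {g : ℕ} (hg : 2 ≤ g) {k : ℝ} {C x : 𝔻} (hk : 1 ≤ k)
    (hC : IsClear g k C) {j : ℤ}
    (h : (space C * conj (sideDir g j)).re ≤ ‖space (C : ℂ)‖ * Real.cos (2 * ang g))
    (hx : coshDist C x ≤ k) : 0 < sideForm g (sideDir g j) x := by
  obtain ⟨θ, q, i, hθ0, hθ, hq, hqle, hi⟩ := exists_near_sideDir hg _ _ h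
  have hm := hC.2 i
  rw [hi] at hm
  have key := disk_far_from_side (ang_pos hg) (ang_le hg) (rad_pos hg) (rad_sq hg) hθ0 hθ
    (time_pos C) (norm_nonneg (space (C : ℂ))) (time_sq_norm C) hk hC.1 (by linarith) hqle
  have e : time C * rad g - Real.cos (ang g) * ‖space (C : ℂ)‖ * q = sideForm g (sideDir g j) C := by
    rw [sideForm, hq]; ring
  rw [e, sideForm_eq] at key
  rw [sideForm_eq]
  refine disk_subset_halfPlane (s := Real.sin (ang g)) ?_ key.1 key.2 hx
  have hn := normSq_dir (2 * j * ang g)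
  rw [normSq_apply] at hn
  rw [re_ofReal_mul, im_ofReal_mul, sideDir]
  linear_combination rad_sq' hg - Real.cos (ang g) ^ 2 * hn

/-! ### The action of the group -/

theorem coe_moebius (a b : ℂ) (h : normSq a - normSq b = 1) (z : 𝔻) :
    (moebius a b h z : ℂ) = (a * z + b) / (conj b * z + conj a) := rfl

theorem one_sub_normSq_moebius (a b : ℂ) (h : normSq a - normSq b = 1) (z : 𝔻) :
    1 - normSq (moebius a b h z : ℂ) =
      (1 - normSq (z : ℂ)) / normSq (conj b * (z : ℂ) + conj a) := by
  have h0 : normSq (conj b * (z : ℂ) + conj a) ≠ 0 := normSq_eq_zero.not.2 (denom_ne_zero a b h z)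
  have h1 := normSq_sub_normSq a b z
  rw [h, one_mul] at h1
  rw [coe_moebius, normSq_div, ← h1, sub_div, div_self h0]

/-- With `space_moebius`, this expresses that the automorphism acts linearly on hyperboloid
coordinates. -/
theorem time_moebius (a b : ℂ) (h : normSq a - normSq b = 1) (z : 𝔻) :
    time (moebius a b h z) =
      (normSq a + normSq b) * time z + 2 * (a * conj b * space z).re := by
  have h0 : normSq (conj b * (z : ℂ) + conj a) ≠ 0 := normSq_eq_zero.not.2 (denom_ne_zero a b h z)
  have h1 : 1 - normSq (z : ℂ) ≠ 0 := by linarith [z.normSq_lt_one]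
  rw [time, one_sub_normSq_moebius, coe_moebius, normSq_div, time, space, mul_left_comm,
    re_ofReal_mul]
  have e : normSq (a * (z : ℂ) + b) + normSq (conj b * (z : ℂ) + conj a) =
      (normSq a + normSq b) * (1 + normSq (z : ℂ)) + 4 * (a * conj b * z).re := by
    simp only [normSq_apply, add_re, add_im, mul_re, mul_im, conj_re, conj_im]
    ring
  generalize normSq (conj b * (z : ℂ) + conj a) = d at h0 e ⊢
  generalize (a * conj b * z).re = q at e ⊢
  field_simp
  linear_combination e

theorem space_moebius (a b : ℂ) (h : normSq a - normSq b = 1) (z : 𝔻) :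
    space (moebius a b h z) =
      a ^ 2 * space z + b ^ 2 * conj (space z) + 2 * a * b * time z := by
  have hd := denom_ne_zero a b h z
  have h0 : normSq (conj b * (z : ℂ) + conj a) ≠ 0 := normSq_eq_zero.not.2 hd
  have h1 : 1 - normSq (z : ℂ) ≠ 0 := by linarith [z.normSq_lt_one]
  have e1 : 2 / (1 - normSq (moebius a b h z : ℂ)) =
      normSq (conj b * (z : ℂ) + conj a) * (2 / (1 - normSq (z : ℂ))) := by
    rw [one_sub_normSq_moebius]; field_simp
  have e2 : ((normSq (conj b * (z : ℂ) + conj a) : ℝ) : ℂ) * (moebius a b h z : ℂ) =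
      (a * z + b) * (b * conj (z : ℂ) + a) := by
    rw [coe_moebius, ← mul_conj, map_add, map_mul, conj_conj, conj_conj]
    field_simp
  have e3 : ((time z : ℝ) : ℂ) = ((2 / (1 - normSq (z : ℂ)) : ℝ) : ℂ) * (1 + z * conj (z : ℂ)) / 2 := by
    rw [time, mul_conj]; push_cast; ring
  rw [space, e1, ofReal_mul, mul_right_comm, e2, e3, space, map_mul, conj_ofReal]
  ring

theorem coshDist_moebius (a b : ℂ) (h : normSq a - normSq b = 1) (z w : 𝔻) :
    coshDist (moebius a b h z) (moebius a b h w) = coshDist z w := by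
  have hz := denom_ne_zero a b h z
  have hw := denom_ne_zero a b h w
  have hz' := normSq_eq_zero.not.2 hz
  have hw' := normSq_eq_zero.not.2 hw
  have h1 : 1 - normSq (z : ℂ) ≠ 0 := by linarith [z.normSq_lt_one]
  have h2 : 1 - normSq (w : ℂ) ≠ 0 := by linarith [w.normSq_lt_one]
  rw [coshDist_eq (UnitDisc.normSq_lt_one _) (UnitDisc.normSq_lt_one _),
    coshDist_eq z.normSq_lt_one w.normSq_lt_one, one_sub_normSq_moebius, one_sub_normSq_moebius]
  have e : (moebius a b h z : ℂ) - moebius a b h w =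
      (z - w) / ((conj b * z + conj a) * (conj b * w + conj a)) := by
    have h' : a * conj a - b * conj b = 1 := by
      rw [mul_conj, mul_conj, ← ofReal_sub, h, ofReal_one]
    rw [coe_moebius, coe_moebius, div_sub_div _ _ hz hw]
    congr 1
    linear_combination ((z : ℂ) - w) * h'
  rw [e, normSq_div, normSq_mul]
  generalize normSq (conj b * (z : ℂ) + conj a) = d at hz' ⊢
  generalize normSq (conj b * (w : ℂ) + conj a) = d' at hw' ⊢
  field_simp

theorem perm_apply_inv (f : Equiv.Perm 𝔻) (z : 𝔻) : f (f⁻¹ z) = z := f.apply_symm_apply z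

theorem coshDist_group {g : ℕ} {hg : 2 ≤ g} {f : Equiv.Perm 𝔻} (hf : f ∈ group g hg) :
    ∀ z w : 𝔻, coshDist (f z) (f w) = coshDist z w := by
  refine Subgroup.closure_induction (p := fun f _ => ∀ z w : 𝔻, coshDist (f z) (f w) = coshDist z w)
    ?_ ?_ ?_ ?_ hf
  · rintro _ ⟨j, -, rfl⟩ z w
    exact coshDist_moebius _ _ _ z w
  · intro z w
    rfl
  · intro f f' _ _ h h' z w
    rw [Equiv.Perm.mul_apply, Equiv.Perm.mul_apply, h, h']
  · intro f _ h z w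
    rw [← h, perm_apply_inv, perm_apply_inv]

/-! ### The generators in hyperboloid coordinates. -/

theorem sqrt_cot {g : ℕ} (hg : 2 ≤ g) :
    √(Real.cot (Real.pi / (4 * g)) ^ 2 - 1) = rad g / Real.sin (ang g) := by
  have hs := sin_ang_pos hg
  have e : Real.cot (Real.pi / (4 * g)) ^ 2 - 1 = (rad g / Real.sin (ang g)) ^ 2 := by
    rw [Real.cot_eq_cos_div_sin, ← ang, div_pow, div_pow, rad_sq' hg]
    field_simp
  rw [e, Real.sqrt_sq (div_nonneg (rad_pos hg).le hs.le)]

theorem exp_eq_sideDir (g j : ℕ) : exp (I * j * Real.pi / (2 * g)) = sideDir g j := by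
  rw [sideDir, dir, ang]
  congr 1
  push_cast
  ring

theorem generator_mem {g : ℕ} (hg : 2 ≤ g) (j : ℕ) : generator g hg j ∈ group g hg := by
  refine Subgroup.subset_closure ⟨j % (4 * g), Nat.mod_lt _ (by omega), ?_⟩
  have h := sideDir_add hg ((j % (4 * g) : ℕ) : ℤ) ((j / (4 * g) : ℕ) : ℤ)
  have e : (((j % (4 * g) : ℕ) : ℤ) + ((j / (4 * g) : ℕ) : ℤ) * (4 * g)) = (j : ℤ) := by
    exact_mod_cast Nat.mod_add_div' j (4 * g)
  rw [e] at h
  simp only [generator, exp_eq_sideDir, h]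

/-- `f_j` is the translation along the axis through the origin and the midpoint of `s_j`, by twice
their distance. In the frame of `sideDir g j` its inverse is a boost, which fixes the coordinate
perpendicular to the axis. -/
theorem coord_generator_inv {g : ℕ} (hg : 2 ≤ g) (j : ℕ) (z : 𝔻) :
    time ((generator g hg j)⁻¹ z : 𝔻) * Real.sin (ang g) ^ 2 =
        (Real.cos (ang g) ^ 2 + rad g ^ 2) * time z -
          2 * Real.cos (ang g) * rad g * (space z * conj (sideDir g j)).re ∧
      (space ((generator g hg j)⁻¹ z : 𝔻) * conj (sideDir g j)).re * Real.sin (ang g) ^ 2 =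
        (Real.cos (ang g) ^ 2 + rad g ^ 2) * (space z * conj (sideDir g j)).re -
          2 * Real.cos (ang g) * rad g * time z ∧
      (space ((generator g hg j)⁻¹ z : 𝔻) * conj (sideDir g j)).im =
        (space z * conj (sideDir g j)).im := by
  have hs := sin_ang_pos hg
  have hdet := generator_det hg j
  have e : ∀ (h : _), (generator g hg j)⁻¹ z =
      moebius (conj (Real.cot (Real.pi / (4 * g)) : ℂ))
        (-(exp (I * j * Real.pi / (2 * g)) * (√(Real.cot (Real.pi / (4 * g)) ^ 2 - 1) : ℝ))) h z :=
    fun h => rfl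
  rw [e (by rwa [normSq_conj, normSq_neg]), time_moebius, space_moebius]
  rw [conj_ofReal, sqrt_cot hg, exp_eq_sideDir, Real.cot_eq_cos_div_sin, ← ang]
  have hn : normSq (sideDir g j) = 1 := normSq_dir _
  have hn' := hn
  rw [normSq_apply] at hn'
  have hR := rad_sq' hg
  set u := sideDir g j
  set w := space (z : ℂ)
  set s := Real.sin (ang g)
  set c := Real.cos (ang g)
  have hab : (c / s) ^ 2 - (rad g / s) ^ 2 = 1 := by
    rw [div_pow, div_pow, hR]; field_simp; ring
  have huu : u * conj u = 1 := by rw [mul_conj, hn, ofReal_one]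
  have e2 : (((c / s : ℝ) : ℂ) ^ 2 * w + (-(u * ((rad g / s : ℝ) : ℂ))) ^ 2 * conj w +
      2 * ((c / s : ℝ) : ℂ) * -(u * ((rad g / s : ℝ) : ℂ)) * time z) * conj u =
      (((c / s) ^ 2 : ℝ) : ℂ) * (w * conj u) + (((rad g / s) ^ 2 : ℝ) : ℂ) * conj (w * conj u) -
        ((2 * (c / s) * (rad g / s) * time z : ℝ) : ℂ) := by
    rw [map_mul, conj_conj]
    push_cast
    linear_combination ((rad g / s : ℂ) ^ 2 * u * conj w - 2 * (c / s) * (rad g / s) * time z) * huu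
  rw [e2]
  refine ⟨?_, ?_, ?_⟩
  · rw [normSq_neg, normSq_mul, hn, normSq_ofReal, normSq_ofReal]
    have e3 : ((c / s : ℝ) : ℂ) * conj (-(u * ((rad g / s : ℝ) : ℂ))) * w =
        ((-(c / s * (rad g / s)) : ℝ) : ℂ) * (w * conj u) := by
      rw [map_neg, map_mul, conj_ofReal]; push_cast; ring
    rw [e3, re_ofReal_mul]
    field_simp
    ring
  · rw [sub_re, add_re, re_ofReal_mul, re_ofReal_mul, conj_re, ofReal_re]
    field_simp
  · rw [sub_im, add_im, im_ofReal_mul, im_ofReal_mul, conj_im, ofReal_im]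
    linear_combination (w * conj u).im * hab

/-! ### Going around a vertex -/

/-- The point `C` is in the sector of the polygon around the vertex in direction `v`. -/
def InSector (g : ℕ) (v C : ℂ) : Prop :=
  ‖space C‖ * Real.cos (ang g) ≤ (space C * conj v).re

/-- The direction of a point, seen from the vertex in direction `v`; the rays from the vertex to
the centre and along the sides have the arguments `0` and `± ang g`. -/
def corner (g : ℕ) (v z : ℂ) : ℂ :=
  ⟨(rad g * time z - Real.cos (ang g) ^ 2 * (space z * conj v).re) / Real.sin (ang g),
    -Real.sin (ang g) * (space z * conj v).im⟩

theorem cos_sign_mul {σ : ℝ} (hσ : σ = 1 ∨ σ = -1) (a : ℝ) : Real.cos (σ * a) = Real.cos a := by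
  rcases hσ with rfl | rfl <;> simp

theorem sin_sign_mul {σ : ℝ} (hσ : σ = 1 ∨ σ = -1) (a : ℝ) :
    Real.sin (σ * a) = σ * Real.sin a := by
  rcases hσ with rfl | rfl <;> simp

theorem sign_sq {σ : ℝ} (hσ : σ = 1 ∨ σ = -1) : σ ^ 2 = 1 := by
  rcases hσ with rfl | rfl <;> norm_num

/-- For a vertex direction `v`, `corner g v` is `sin A` times the linear projection onto the tangent
plane at the vertex. The form of a side through the vertex vanishes there, so it factors through
this projection. -/
theorem corner_mul_dir_im {g : ℕ} (hg : 2 ≤ g) {σ : ℝ} (hσ : σ = 1 ∨ σ = -1) (v z : ℂ) :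
    (corner g v z * dir (σ * ang g)).im = σ * sideForm g (v * dir (σ * ang g)) z := by
  have hs := (sin_ang_pos hg).ne'
  have e : space z * conj (v * dir (σ * ang g)) = space z * conj v * conj (dir (σ * ang g)) := by
    rw [map_mul, mul_assoc]
  rw [sideForm, e, mul_im, mul_re, conj_re, conj_im, dir_re, dir_im, cos_sign_mul hσ,
    sin_sign_mul hσ, corner]
  field_simp
  linear_combination Real.cos (ang g) * Real.sin (ang g) * (space z * conj v).im * sign_sq hσ

/-- The side `s_j` next to the vertex `v_i`, and the vertex which the generator `f_j` maps
to `v_i`. -/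
theorem exists_next {g : ℕ} (hg : 2 ≤ g) {σ : ℝ} (hσ : σ = 1 ∨ σ = -1) (i : ℕ) :
    ∃ j i' : ℕ, sideDir g j = vertexDir g i * dir (σ * ang g) ∧
      vertexDir g i' = -(vertexDir g i * dir (2 * σ * ang g)) := by
  rcases hσ with rfl | rfl
  · refine ⟨i, i + 2 * g + 1, ?_, ?_⟩
    · rw [sideDir, vertexDir, ← dir_add]; congr 1; push_cast; ring
    · rw [vertexDir, vertexDir, ← dir_add, ← dir_add_pi, ← ang_mul hg]; congr 1; push_cast; ring
  -- The side index is `i - 1` shifted by a full period, as `i` may be `0`.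
  · refine ⟨i + 4 * g - 1, i + 2 * g - 1, ?_, ?_⟩
    · rw [sideDir, vertexDir, ← dir_add, ← dir_add_int_mul_two_pi ((2 * (i : ℤ) - 1) * ang g + _) 1,
        ← ang_mul hg]
      congr 1
      push_cast [Nat.cast_sub (by omega : 1 ≤ i + 4 * g)]
      ring
    · rw [vertexDir, vertexDir, ← dir_add, ← dir_add_pi, ← ang_mul hg]
      congr 1
      push_cast [Nat.cast_sub (by omega : 1 ≤ i + 2 * g)]
      ring

/-- `f_j⁻¹` carries `v_i` to `v_{i'}`, hence induces an isometry of the tangent planes there.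
Measured from the directions of the centre, it is the rotation by the interior angle `2A`. -/
theorem corner_generator_inv {g : ℕ} (hg : 2 ≤ g) {σ : ℝ} (hσ : σ = 1 ∨ σ = -1) {i j i' : ℕ}
    (hj : sideDir g j = vertexDir g i * dir (σ * ang g))
    (hi' : vertexDir g i' = -(vertexDir g i * dir (2 * σ * ang g))) (z : 𝔻) :
    corner g (vertexDir g i') ((generator g hg j)⁻¹ z : 𝔻) =
      dir (2 * σ * ang g) * corner g (vertexDir g i) z := by
  have hs := sin_ang_pos hg
  obtain ⟨h1, h2, h3⟩ := coord_generator_inv hg j z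
  have hee : dir (σ * ang g) * conj (dir (σ * ang g)) = 1 := dir_mul_conj_self _
  have hd : dir (2 * σ * ang g) = dir (σ * ang g) * dir (σ * ang g) := by
    rw [← dir_add]; congr 1; ring
  have e1 : conj (vertexDir g i) = conj (sideDir g j) * dir (σ * ang g) := by
    rw [hj, map_mul, mul_assoc, mul_comm (conj (dir _)), hee, mul_one]
  have e2 : conj (vertexDir g i') = -(conj (sideDir g j) * conj (dir (σ * ang g))) := by
    rw [hi', hd, map_neg, map_mul, map_mul, e1]
    linear_combination (-conj (sideDir g j) * conj (dir (σ * ang g))) * hee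
  have hone := Real.sin_sq_add_cos_sq (ang g)
  have hR := rad_sq' hg
  have hσ2 := sign_sq hσ
  simp only [corner, e1, e2, hd, mul_neg, ← mul_assoc, neg_re, neg_im]
  generalize space (z : ℂ) * conj (sideDir g j) = W at h1 h2 h3 ⊢
  generalize space (((generator g hg j)⁻¹ z : 𝔻) : ℂ) * conj (sideDir g j) = W' at h1 h2 h3 ⊢
  generalize time (((generator g hg j)⁻¹ z : 𝔻) : ℂ) = T' at h1 ⊢
  generalize time (z : ℂ) = T at h1 h2 ⊢
  apply Complex.ext
  · simp only [mul_re, mul_im, conj_re, conj_im, dir_re, dir_im, cos_sign_mul hσ, sin_sign_mul hσ]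
    generalize Real.sin (ang g) = s at *
    generalize Real.cos (ang g) = c at *
    generalize rad g = R at *
    rw [← eq_div_iff (by positivity)] at h1 h2
    rw [h1, h2, h3]
    field_simp
    clear hj hi' hee hd e1 e2 hσ
    grind
  · simp only [mul_re, mul_im, conj_re, conj_im, dir_re, dir_im, cos_sign_mul hσ, sin_sign_mul hσ]
    generalize Real.sin (ang g) = s at *
    generalize Real.cos (ang g) = c at *
    generalize rad g = R at *
    rw [← eq_div_iff (by positivity)] at h1 h2
    rw [h2, h3]
    field_simp
    clear hj hi' hee hd e1 e2 hσ
    grind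

/-- `f_j⁻¹` carries the line of `s_j` to the line of the opposite side and exchanges inner and outer
sides. -/
theorem sideForm_generator_inv {g : ℕ} (hg : 2 ≤ g) (j : ℕ) (z : 𝔻) :
    sideForm g (-sideDir g j) ((generator g hg j)⁻¹ z : 𝔻) = -sideForm g (sideDir g j) z := by
  have hs := sin_ang_pos hg
  obtain ⟨h1, h2, -⟩ := coord_generator_inv hg j z
  have hR := rad_sq' hg
  simp only [sideForm, map_neg, mul_neg, neg_re]
  apply mul_right_cancel₀ (pow_pos hs 2).ne'
  generalize space (z : ℂ) * conj (sideDir g j) = W at *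
  linear_combination rad g * h1 + Real.cos (ang g) * h2 +
    (rad g * time z - Real.cos (ang g) * W.re) * hR

/-- The image of `p` is not strictly inside the side opposite to `s_j`, so the moved disk reaches
that line and its centre is within `2A` of the opposite midpoint direction. The translation keeps
the centre on its side of the axis, and the half of this double sector on that side is the sector of
`v_{i'}`. -/
theorem inSector_generator_inv {g : ℕ} (hg : 2 ≤ g) {σ : ℝ} (hσ : σ = 1 ∨ σ = -1) {i j i' : ℕ}
    (hj : sideDir g j = vertexDir g i * dir (σ * ang g))
    (hi' : vertexDir g i' = -(vertexDir g i * dir (2 * σ * ang g))) {k : ℝ} {C p : 𝔻} (hk : 1 ≤ k)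
    (hclear : IsClear g k ((generator g hg j)⁻¹ C : 𝔻)) (hC : InSector g (vertexDir g i) C)
    (hp : coshDist C p ≤ k) (hside : 0 ≤ sideForm g (sideDir g j) p) :
    InSector g (vertexDir g i') ((generator g hg j)⁻¹ C : 𝔻) := by
  have hs := sin_ang_pos hg
  have hc := cos_ang_pos hg
  have hc2 := cos_two_ang_pos hg
  have hone := Real.sin_sq_add_cos_sq (ang g)
  have hee : dir (σ * ang g) * conj (dir (σ * ang g)) = 1 := dir_mul_conj_self _
  have hopp : sideDir g (j + 2 * g) = -sideDir g j := by
    rw [sideDir, sideDir, ← dir_add_pi, ← ang_mul hg]; congr 1; push_cast; ring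
  have e1 : conj (vertexDir g i) = conj (sideDir g j) * dir (σ * ang g) := by
    rw [hj, map_mul, mul_assoc, mul_comm (conj (dir _)), hee, mul_one]
  have hd : dir (2 * σ * ang g) = dir (σ * ang g) * dir (σ * ang g) := by
    rw [← dir_add]; congr 1; ring
  have e2 : conj (vertexDir g i') = -(conj (sideDir g j) * conj (dir (σ * ang g))) := by
    rw [hi', hd, map_neg, map_mul, map_mul, e1]
    linear_combination (-conj (sideDir g j) * conj (dir (σ * ang g))) * hee
  have him := (coord_generator_inv hg j C).2.2
  have hfar : ‖space (((generator g hg j)⁻¹ C : 𝔻) : ℂ)‖ * Real.cos (2 * ang g) <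
      (space (((generator g hg j)⁻¹ C : 𝔻) : ℂ) * conj (-sideDir g j)).re := by
    by_contra! hcon
    have h1 := sideForm_pos_of_isClear hg (x := (generator g hg j)⁻¹ p) (j := j + 2 * g) hk hclear
      (by rwa [hopp]) (by rwa [coshDist_group (inv_mem (generator_mem hg j))])
    rw [hopp, sideForm_generator_inv] at h1
    linarith
  rw [InSector, e1, ← mul_assoc, mul_re, dir_re, dir_im, cos_sign_mul hσ, sin_sign_mul hσ] at hC
  rw [InSector, e2, mul_neg, neg_re, ← mul_assoc, mul_re, conj_re, conj_im, dir_re, dir_im,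
    cos_sign_mul hσ, sin_sign_mul hσ]
  rw [map_neg, mul_neg, neg_re] at hfar
  have hn1 : ‖space (C : ℂ)‖ = ‖space (C : ℂ) * conj (sideDir g j)‖ := by
    rw [norm_mul, norm_conj, norm_sideDir, mul_one]
  have hn2 : ‖space (((generator g hg j)⁻¹ C : 𝔻) : ℂ)‖ =
      ‖space (((generator g hg j)⁻¹ C : 𝔻) : ℂ) * conj (sideDir g j)‖ := by
    rw [norm_mul, norm_conj, norm_sideDir, mul_one]
  rw [hn1] at hC
  rw [hn2] at hfar ⊢
  generalize space (C : ℂ) * conj (sideDir g j) = W at hC him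
  generalize space (((generator g hg j)⁻¹ C : 𝔻) : ℂ) * conj (sideDir g j) = Y at hfar him ⊢
  -- The centre stays on the side of the axis where `v_i` and `v_{i'}` lie.
  have ht : σ * Y.im ≤ 0 := by
    have h1 := mul_le_mul_of_nonneg_right (re_le_norm W) hc.le
    rw [him]
    have h2 : (σ * W.im) * Real.sin (ang g) ≤ 0 := by linarith
    exact nonpos_of_mul_nonpos_left h2 hs
  have hN : ‖Y‖ ^ 2 = Y.re ^ 2 + (σ * Y.im) ^ 2 := by
    rw [← normSq_eq_norm_sq, normSq_apply, mul_pow, sign_sq hσ]; ring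
  have hN0 := norm_nonneg Y
  rw [Real.cos_two_mul'] at hfar hc2
  generalize ‖Y‖ = N at *
  obtain ⟨t, htdef⟩ : ∃ t, t = -(σ * Y.im) := ⟨_, rfl⟩
  obtain ⟨y, hydef⟩ : ∃ y, y = -Y.re := ⟨_, rfl⟩
  have hN' : N ^ 2 = y ^ 2 + t ^ 2 := by rw [hN, htdef, hydef]; ring
  have ht0 : 0 ≤ t := by rw [htdef]; linarith
  rw [← hydef] at hfar
  -- With `y = N cos φ` and `t = N sin φ`, this is `tan (φ/2) ≤ tan A`, from `0 ≤ φ < 2A`.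
  have goal' : Real.cos (ang g) * (N - y) ≤ Real.sin (ang g) * t := by
    have hy0 : 0 < y := (mul_nonneg hN0 hc2.le).trans_lt hfar
    have htN : t ≤ N * (2 * Real.sin (ang g) * Real.cos (ang g)) := by
      apply le_of_sq_le_sq _ (by positivity)
      have h1 := pow_le_pow_left₀ (mul_nonneg hN0 hc2.le) hfar.le 2
      have h2 : (Real.cos (ang g) ^ 2 - Real.sin (ang g) ^ 2) ^ 2 =
          1 - (2 * Real.sin (ang g) * Real.cos (ang g)) ^ 2 := by
        linear_combination (1 + Real.sin (ang g) ^ 2 + Real.cos (ang g) ^ 2) * hone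
      rw [mul_pow, h2] at h1
      rw [mul_pow]
      linarith
    have h3 : Real.cos (ang g) * t ≤ Real.sin (ang g) * (N + y) := by
      have h4 := mul_le_mul_of_nonneg_left htN hc.le
      have h5 := mul_le_mul_of_nonneg_left hfar.le hs.le
      have h6 : Real.cos (ang g) * (N * (2 * Real.sin (ang g) * Real.cos (ang g))) =
          Real.sin (ang g) * (N + N * (Real.cos (ang g) ^ 2 - Real.sin (ang g) ^ 2)) := by
        linear_combination (N * Real.sin (ang g)) * hone
      linarith
    have h7 := mul_le_mul_of_nonneg_right h3 ht0
    refine le_of_mul_le_mul_right ?_ (by linarith : 0 < N + y)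
    have h8 : Real.cos (ang g) * (N - y) * (N + y) = Real.cos (ang g) * t * t := by
      linear_combination Real.cos (ang g) * hN'
    rw [h8]
    linarith
  have e3 : -(Y.re * Real.cos (ang g) - Y.im * -(σ * Real.sin (ang g))) =
      Real.cos (ang g) * y + Real.sin (ang g) * t := by
    rw [htdef, hydef]; ring
  rw [e3]
  linarith

/-- Each step turns the picture at the current vertex by `2A`, so the successive side lines, pulled
back to the first vertex, appear at the odd multiples of `A`; `hside` puts `p` on the required side
of each of them. -/
theorem exists_walk {g : ℕ} (hg : 2 ≤ g) {σ : ℝ} (hσ : σ = 1 ∨ σ = -1) {k : ℝ} {C p : 𝔻}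
    (hk : 1 ≤ k) (hclear : ∀ h ∈ group g hg, IsClear g k (h C)) (hp : coshDist C p ≤ k) (i₀ : ℕ)
    (hC : InSector g (vertexDir g i₀) C) (n : ℕ)
    (hside : ∀ m < n, 0 ≤ σ * (corner g (vertexDir g i₀) p *
      dir (σ * ((2 * m + 1) * ang g))).im) :
    ∃ h ∈ group g hg, ∃ i : ℕ, InSector g (vertexDir g i) (h C) ∧ ∀ z : 𝔻,
      corner g (vertexDir g i) (h z) =
        dir (σ * (2 * n * ang g)) * corner g (vertexDir g i₀) z := by
  induction n with
  | zero =>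
    refine ⟨1, one_mem _, i₀, hC, fun z => ?_⟩
    simp
  | succ n ih =>
    obtain ⟨h, hh, i, hi, hz⟩ := ih fun m hm => hside m (by omega)
    obtain ⟨j, i', hj, hi'⟩ := exists_next hg hσ i
    have hmem : (generator g hg j)⁻¹ * h ∈ group g hg := mul_mem (inv_mem (generator_mem hg j)) hh
    refine ⟨_, hmem, i', ?_, fun z => ?_⟩
    · refine inSector_generator_inv hg hσ hj hi' (p := h p) hk (hclear _ hmem) hi
        (by rwa [coshDist_group hh]) ?_
      have h1 := hside n (by omega)
      have h2 := corner_mul_dir_im hg hσ (vertexDir g i) (h p)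
      have h3 : dir (σ * ((2 * n + 1) * ang g)) = dir (σ * (2 * n * ang g)) * dir (σ * ang g) := by
        rw [← dir_add]; congr 1; ring
      rw [hz, ← hj] at h2
      rw [h3, ← mul_assoc, mul_comm (corner _ _ _), h2, ← mul_assoc, ← sq, sign_sq hσ,
        one_mul] at h1
      exact h1
    · rw [Equiv.Perm.mul_apply, corner_generator_inv hg hσ hj hi', hz, ← mul_assoc, ← dir_add]
      congr 2
      push_cast
      ring

theorem corner_vertex {g : ℕ} (hg : 2 ≤ g) (i : ℕ) :
    corner g (vertexDir g i) (vertex g hg i) = 0 := by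
  rw [corner, time_vertex, space_vertex, mul_assoc, vertexDir, dir_mul_conj_self, mul_one,
    ofReal_re, ofReal_im]
  apply Complex.ext
  · simp only [zero_re]; ring
  · simp

/-- The kernel of the projection is the line spanned by the vertex, which meets the sheet of
positive time once. -/
theorem eq_vertex_of_corner_eq_zero {g : ℕ} (hg : 2 ≤ g) (i : ℕ) {z : 𝔻}
    (h : corner g (vertexDir g i) z = 0) : z = vertex g hg i := by
  have hs := sin_ang_pos hg
  have hc := cos_ang_pos hg
  have hR := rad_pos hg
  have hR2 := rad_sq' hg
  have hone := Real.sin_sq_add_cos_sq (ang g)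
  have hT := time_pos z
  have hsq := time_sq_norm z
  have hre : (rad g * time z - Real.cos (ang g) ^ 2 *
      (space z * conj (vertexDir g i)).re) / Real.sin (ang g) = 0 := congr_arg Complex.re h
  have him : -Real.sin (ang g) * (space (z : ℂ) * conj (vertexDir g i)).im = 0 :=
    congr_arg Complex.im h
  rw [div_eq_zero_iff, or_iff_left hs.ne'] at hre
  rw [mul_eq_zero, or_iff_right (neg_ne_zero.2 hs.ne')] at him
  have hn : ‖space (z : ℂ)‖ = ‖space (z : ℂ) * conj (vertexDir g i)‖ := by
    rw [norm_mul, norm_conj, norm_vertexDir, mul_one]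
  rw [hn, ← normSq_eq_norm_sq, normSq_apply, him, mul_zero, add_zero] at hsq
  have hw : space (z : ℂ) = space (z : ℂ) * conj (vertexDir g i) * vertexDir g i := by
    rw [mul_assoc, mul_comm (conj _), vertexDir, dir_mul_conj_self, mul_one]
  obtain ⟨x, hx⟩ : ∃ x, x = (space (z : ℂ) * conj (vertexDir g i)).re := ⟨_, rfl⟩
  have hwx : space (z : ℂ) * conj (vertexDir g i) = x := by
    apply Complex.ext
    · rw [ofReal_re, hx]
    · rw [ofReal_im, him]
  rw [← hx] at hre hsq
  have hx0 : 0 < x := by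
    have : 0 < Real.cos (ang g) ^ 2 * x := by
      have := mul_pos hR hT
      linarith
    exact pos_of_mul_pos_right this (sq_nonneg _)
  have hxs : x * Real.sin (ang g) ^ 2 = rad g := by
    apply (pow_left_inj₀ (by positivity) hR.le two_ne_zero).1
    have h1 : rad g * time z = Real.cos (ang g) ^ 2 * x := by linarith
    have h2 : rad g ^ 2 * (1 + x * x) = (Real.cos (ang g) ^ 2 * x) ^ 2 := by
      rw [← h1, mul_pow, hsq]
    have h3 : Real.cos (ang g) ^ 4 - rad g ^ 2 = Real.sin (ang g) ^ 4 := by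
      rw [hR2]
      linear_combination (Real.cos (ang g) ^ 2 - Real.sin (ang g) ^ 2) * hone
    linear_combination (-x ^ 2) * h3 - h2
  have hx' : x = rad g / Real.sin (ang g) ^ 2 := by
    rw [← hxs]; field_simp
  apply ext_coord
  · rw [time_vertex]
    have h1 : rad g * time z = Real.cos (ang g) ^ 2 * x := by linarith
    rw [hx'] at h1
    field_simp at h1 ⊢
    linarith
  · rw [space_vertex, hw, hwx, hx']

/-! ### From the walk to the neighborhood. -/

/-- If the centre of an empty disk is in the sector around a vertex, then the part of the disk in
the wedge at this vertex is contained in the polygon. -/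
theorem mem_polygon_of_inSector {g : ℕ} (hg : 2 ≤ g) {k : ℝ} {C x : 𝔻} {i : ℕ} (hk : 1 ≤ k)
    (hclear : IsClear g k C) (hC : InSector g (vertexDir g i) C) (hx : coshDist C x ≤ k)
    (h1 : 0 ≤ (corner g (vertexDir g i) x * dir (ang g)).im)
    (h2 : (corner g (vertexDir g i) x * dir (-ang g)).im ≤ 0) : x ∈ polygon g hg := by
  have hA := ang_pos hg
  have hA8 := ang_le hg
  have hpi := Real.pi_pos
  have hgA := ang_mul hg
  have e1 := corner_mul_dir_im hg (Or.inl rfl) (vertexDir g i) x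
  have e2 := corner_mul_dir_im hg (Or.inr rfl) (vertexDir g i) x
  rw [one_mul, one_mul] at e1
  rw [neg_one_mul, neg_one_mul] at e2
  rw [e1] at h1
  rw [e2] at h2
  apply mem_polygon_of_sideForm_nonneg hg
  intro j
  -- Representatives in `[-2g, 2g)` keep the angles to the centre at most `π`, where the cosine is
  -- monotone; `m = 0` and `m = -1` are the two sides at the vertex.
  obtain ⟨m, n, hm1, hm2, hj⟩ : ∃ m n : ℤ, -(2 * g) ≤ m ∧ m < 2 * g ∧ j = i + m + n * (4 * g) := by
    refine ⟨(j - i + 2 * g) % (4 * g) - 2 * g, (j - i + 2 * g) / (4 * g), ?_, ?_, ?_⟩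
    · have := Int.emod_nonneg (j - i + 2 * g) (by omega : (4 * g : ℤ) ≠ 0)
      omega
    · have := Int.emod_lt_of_pos (j - i + 2 * g) (by omega : (0 : ℤ) < 4 * g)
      omega
    · have := Int.emod_add_mul_ediv (j - i + 2 * g) (4 * g)
      linarith
  have hdir : sideDir g (i + m) = vertexDir g i * dir ((2 * m + 1) * ang g) := by
    rw [sideDir, vertexDir, ← dir_add]; congr 1; push_cast; ring
  rw [hj, sideDir_add hg]
  rcases eq_or_ne m 0 with rfl | hm0
  · rw [hdir]; simpa using h1
  rcases eq_or_ne m (-1) with rfl | hm0'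
  · rw [hdir]
    have : (2 * ((-1 : ℤ) : ℝ) + 1) * ang g = -ang g := by push_cast; ring
    rw [this]
    linarith
  refine (sideForm_pos_of_isClear hg hk hclear ?_ hx).le
  rw [InSector] at hC
  rw [hdir, map_mul, ← mul_assoc]
  have hn : ‖space (C : ℂ)‖ = ‖space (C : ℂ) * conj (vertexDir g i)‖ := by
    rw [norm_mul, norm_conj, norm_vertexDir, mul_one]
  rw [hn] at hC ⊢
  generalize space (C : ℂ) * conj (vertexDir g i) = W at hC ⊢
  rcases (norm_nonneg W).eq_or_lt with h0 | h0
  · rw [norm_eq_zero.1 h0.symm]; simp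
  have hW := norm_mul_dir_arg W
  have hβπ := abs_arg_le_pi W
  set β := arg W
  have hre : W.re = ‖W‖ * Real.cos β := by
    conv_lhs => rw [← hW]
    rw [re_ofReal_mul, dir_re]
  rw [hre] at hC
  have hcos := le_of_mul_le_mul_left hC h0
  have hβ : |β| ≤ ang g := by
    by_contra! hlt
    have := Real.cos_lt_cos_of_nonneg_of_le_pi hA.le hβπ hlt
    rw [Real.cos_abs] at this
    linarith
  have hβ' := abs_le.1 hβ
  have e3 : (W * conj (dir ((2 * m + 1) * ang g))).re =
      ‖W‖ * Real.cos (β - (2 * m + 1) * ang g) := by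
    conv_lhs => rw [← hW]
    rw [mul_assoc, dir_mul_conj, re_ofReal_mul, dir_re]
  rw [e3]
  apply mul_le_mul_of_nonneg_left _ h0.le
  rw [← Real.cos_abs (β - _)]
  apply Real.cos_le_cos_of_nonneg_of_le_pi (by linarith)
  · have m1 : (-(2 * g) : ℝ) ≤ m := by exact_mod_cast hm1
    have m2 : (m : ℝ) + 1 ≤ 2 * g := by exact_mod_cast hm2
    have := mul_le_mul_of_nonneg_right m1 hA.le
    have := mul_le_mul_of_nonneg_right m2 hA.le
    rw [abs_le]
    constructor <;> linarith
  -- Here `|2m + 1| ≥ 3`, so the angle is at least `3A - A = 2A`.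
  · rcases (by omega : 1 ≤ m ∨ m ≤ -2) with hm | hm
    · have m1 : (1 : ℝ) ≤ m := by exact_mod_cast hm
      have := mul_le_mul_of_nonneg_right m1 hA.le
      have := neg_abs_le (β - (2 * m + 1) * ang g)
      linarith
    · have m1 : (m : ℝ) ≤ -2 := by exact_mod_cast hm
      have := mul_le_mul_of_nonneg_right m1 hA.le
      have := le_abs_self (β - (2 * m + 1) * ang g)
      linarith

/-- Every direction can be turned into the wedge at a vertex in at most `2 * g` steps. -/
theorem exists_turn {g : ℕ} (hg : 2 ≤ g) (ζ : ℂ) :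
    ∃ (σ : ℝ) (n : ℕ), (σ = 1 ∨ σ = -1) ∧ n ≤ 2 * g ∧
      0 ≤ (dir (σ * (2 * n * ang g)) * ζ * dir (ang g)).im ∧
      (dir (σ * (2 * n * ang g)) * ζ * dir (-ang g)).im ≤ 0 := by
  have hA := ang_pos hg
  have hA8 := ang_le hg
  have hpi := Real.pi_pos
  have hgA := ang_mul hg
  have hζ := norm_mul_dir_arg ζ
  have hαπ := abs_arg_le_pi ζ
  set α := arg ζ
  -- The turn goes against the sign of the argument; rounding leaves an error of at most `A`, and
  -- `|α| ≤ π = 4gA` bounds the number of turns by `2g`.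
  obtain ⟨σ, hσ, hσα⟩ : ∃ σ : ℝ, (σ = 1 ∨ σ = -1) ∧ α = -(σ * |α|) := by
    rcases le_total α 0 with h | h
    · exact ⟨1, Or.inl rfl, by rw [abs_of_nonpos h]; ring⟩
    · exact ⟨-1, Or.inr rfl, by rw [abs_of_nonneg h]; ring⟩
  have hr := abs_le.1 (abs_sub_round (|α| / (2 * ang g)))
  have hy : |α| / (2 * ang g) * (2 * ang g) = |α| := div_mul_cancel₀ _ (by linarith)
  have hy0 : 0 ≤ |α| / (2 * ang g) := by positivity
  set y := |α| / (2 * ang g)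
  have hr0 : 0 ≤ round y := by
    have h2 : (-1 : ℝ) < round y := by linarith
    have h3 : -1 < round y := by exact_mod_cast h2
    omega
  obtain ⟨n, hn⟩ := Int.eq_ofNat_of_zero_le hr0
  rw [hn] at hr
  push_cast at hr
  have hyg : y ≤ 2 * g := by
    have : y * (2 * ang g) ≤ 2 * g * (2 * ang g) := by linarith
    exact le_of_mul_le_mul_right this (by linarith)
  have hδ1 := mul_le_mul_of_nonneg_right hr.1 (by linarith : 0 ≤ 2 * ang g)
  have hδ2 := mul_le_mul_of_nonneg_right hr.2 (by linarith : 0 ≤ 2 * ang g)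
  have hδ : |σ * (2 * n * ang g - |α|)| ≤ ang g := by
    rw [abs_mul, (by rcases hσ with rfl | rfl <;> norm_num : |σ| = 1), one_mul, abs_le]
    constructor <;> linarith
  have hδ' := abs_le.1 hδ
  refine ⟨σ, n, hσ, ?_, ?_, ?_⟩
  · have h1 : (n : ℝ) < 2 * g + 1 := by linarith
    have h2 : n < 2 * g + 1 := by exact_mod_cast h1
    omega
  all_goals
    have e : dir (σ * (2 * n * ang g)) * ζ = ‖ζ‖ * dir (σ * (2 * n * ang g - |α|)) := by
      conv_lhs => rw [← hζ]
      rw [mul_left_comm, ← dir_add]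
      congr 2
      linear_combination hσα
    rw [e, mul_assoc, ← dir_add, im_ofReal_mul, dir_im]
  · exact mul_nonneg (norm_nonneg _)
      (Real.sin_nonneg_of_nonneg_of_le_pi (by linarith) (by linarith))
  · exact mul_nonpos_of_nonneg_of_nonpos (norm_nonneg _)
      (Real.sin_nonpos_of_nonpos_of_neg_pi_le (by linarith) (by linarith))

/-- A point of the wedge at a vertex stays on one side of the lines crossed by at most `2 * g`
steps around the vertex. -/
theorem corner_side {g : ℕ} (hg : 2 ≤ g) {σ : ℝ} (hσ : σ = 1 ∨ σ = -1) {ζ : ℂ}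
    (h1 : 0 ≤ (ζ * dir (ang g)).im) (h2 : (ζ * dir (-ang g)).im ≤ 0) {m : ℕ} (hm : m < 2 * g) :
    0 ≤ σ * (ζ * dir (σ * ((2 * m + 1) * ang g))).im := by
  have hA := ang_pos hg
  have hA8 := ang_le hg
  have hpi := Real.pi_pos
  have hgA := ang_mul hg
  have hm' : (m : ℝ) + 1 ≤ 2 * g := by exact_mod_cast hm
  have hmA := mul_le_mul_of_nonneg_right hm' hA.le
  have hm0 : 0 ≤ m * ang g := by positivity
  have s1 : 0 ≤ Real.sin ((2 * m + 1) * ang g + ang g) :=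
    Real.sin_nonneg_of_nonneg_of_le_pi (by linarith) (by linarith)
  have s2 : 0 ≤ Real.sin ((2 * m + 1) * ang g - ang g) :=
    Real.sin_nonneg_of_nonneg_of_le_pi (by linarith) (by linarith)
  have hone := Real.sin_sq_add_cos_sq (ang g)
  have hs := sin_ang_pos hg
  have hc := cos_ang_pos hg
  rw [mul_im, dir_re, dir_im] at h1 h2 ⊢
  rw [Real.cos_neg, Real.sin_neg] at h2
  rw [cos_sign_mul hσ, sin_sign_mul hσ]
  rw [Real.sin_add] at s1
  rw [Real.sin_sub] at s2
  generalize Real.sin ((2 * m + 1) * ang g) = S at *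
  generalize Real.cos ((2 * m + 1) * ang g) = K at *
  generalize Real.sin (ang g) = s at *
  generalize Real.cos (ang g) = c at *
  -- Multiplied by `sin 2A`, the quantity is a combination of the two wedge conditions with weights
  -- `s1` and `s2`.
  refine nonneg_of_mul_nonneg_left (b := 2 * s * c) ?_ (by positivity)
  rcases hσ with rfl | rfl
  · have h3 := mul_nonneg h1 s1
    have h4 := mul_nonneg (neg_nonneg.2 h2) s2
    nlinarith
  · have h3 := mul_nonneg h1 s2
    have h4 := mul_nonneg (neg_nonneg.2 h2) s1
    nlinarith

/-- A closed disk whose interior contains no Weierstrass point is contained in the neighborhood of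
the polygon if it meets the polygon. -/
theorem mem_neighborhood {g : ℕ} (hg : 2 ≤ g) {k : ℝ} {C p x : 𝔻}
    (hclear : ∀ h ∈ group g hg, IsClear g k (h C)) (hp : p ∈ polygon g hg)
    (hCp : coshDist C p ≤ k) (hCx : coshDist C x ≤ k) : x ∈ neighborhood g hg := by
  have hk : 1 ≤ k := (one_le_coshDist C p).trans hCp
  have hA := ang_pos hg
  -- The shift `δ = A` centres the sectors at the vertices: `v_{j+1}` has argument `(2j + 1)A`.
  obtain ⟨j, θ, hθ, hw⟩ := exists_sector hg (space (C : ℂ)) (δ := ang g) (by rw [abs_of_pos hA])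
  have hsec : InSector g (vertexDir g (j + 1 : ℕ)) C := by
    rw [InSector]
    conv_rhs => rw [hw]
    rw [mul_assoc, vertexDir, dir_mul_conj, re_ofReal_mul, dir_re]
    have e : 2 * j * ang g + ang g + θ - (2 * (((j + 1 : ℕ) : ℤ) : ℝ) - 1) * ang g = θ := by
      push_cast; ring
    rw [e, ← Real.cos_abs θ]
    exact mul_le_mul_of_nonneg_left (Real.cos_le_cos_of_nonneg_of_le_pi (abs_nonneg _)
      (by linarith [ang_le hg, Real.pi_pos]) hθ) (norm_nonneg _)
  generalize j + 1 = i₀ at hsec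
  obtain ⟨σ, n, hσ, hn, hx1, hx2⟩ := exists_turn hg (corner g (vertexDir g i₀) x)
  have hp1 : 0 ≤ (corner g (vertexDir g i₀) p * dir (ang g)).im := by
    have e := corner_mul_dir_im hg (Or.inl rfl) (vertexDir g i₀) p
    rw [one_mul, one_mul] at e
    have e' : vertexDir g i₀ * dir (ang g) = sideDir g i₀ := by
      rw [sideDir, vertexDir, ← dir_add]; congr 1; ring
    rw [e, e']
    exact sideForm_nonneg_of_mem_polygon hg hp _
  have hp2 : (corner g (vertexDir g i₀) p * dir (-ang g)).im ≤ 0 := by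
    have e := corner_mul_dir_im hg (Or.inr rfl) (vertexDir g i₀) p
    rw [neg_one_mul, neg_one_mul] at e
    have e' : vertexDir g i₀ * dir (-ang g) = sideDir g (i₀ - 1) := by
      rw [sideDir, vertexDir, ← dir_add]; congr 1; push_cast; ring
    rw [e, e', neg_nonpos]
    exact sideForm_nonneg_of_mem_polygon hg hp _
  obtain ⟨h, hh, i, hi, hz⟩ := exists_walk hg hσ hk hclear hCp i₀ hsec n fun m hm =>
    corner_side hg hσ hp1 hp2 (by omega)
  have hhx : h x ∈ polygon g hg := by
    rw [← hz] at hx1 hx2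
    exact mem_polygon_of_inSector hg hk (hclear h hh) hi (by rwa [coshDist_group hh]) hx1 hx2
  have hv : h (vertex g hg i₀) = vertex g hg i := by
    apply eq_vertex_of_corner_eq_zero
    rw [hz, corner_vertex, mul_zero]
  -- Since `h` carries `v_{i₀}` to `v_i`, the region `h⁻¹(D_g)` meets `D_g` at `v_{i₀}`.
  refine Set.mem_iUnion₂.2 ⟨h⁻¹, ⟨inv_mem hh, vertex g hg i₀, ⟨vertex g hg i,
    vertex_mem_polygon hg i, ?_⟩, vertex_mem_polygon hg i₀⟩, h x, hhx, h.symm_apply_apply x⟩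
  rw [← hv]
  exact h.symm_apply_apply _

/-! ### From Delaunay triangles to empty disks. -/

theorem proj_group {g : ℕ} {hg : 2 ≤ g} {h : Equiv.Perm 𝔻} (hh : h ∈ group g hg) (z : 𝔻) :
    proj g hg (h z) = proj g hg z :=
  Quotient.sound (s := MulAction.orbitRel (group g hg) 𝔻) ⟨⟨h, hh⟩, rfl⟩

/-- The preimage of the Weierstrass points is invariant under `Γ_g`, so the moved disk has none of
them in its interior either; the origin and the side midpoints are among them. -/
theorem isClear_of_empty {g : ℕ} (hg : 2 ≤ g) {P : Set 𝔻} {k : ℝ} {C : 𝔻}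
    (hP : proj g hg ⁻¹' weierstrassPoints g hg ⊆ P) (hk : ∀ p ∈ P, k ≤ coshDist C p)
    {h : Equiv.Perm 𝔻} (hh : h ∈ group g hg) : IsClear g k (h C) := by
  have key : ∀ p : 𝔻, proj g hg p ∈ weierstrassPoints g hg → k ≤ coshDist (h C) p := by
    intro p hp
    have h1 := hk (h⁻¹ p) (hP (by rwa [Set.mem_preimage, proj_group (inv_mem hh)]))
    rwa [← coshDist_group hh, perm_apply_inv] at h1
  refine ⟨?_, fun j => ?_⟩
  · have := key 0 ⟨0, Or.inl (Or.inl rfl), rfl⟩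
    simpa [coshDist] using this
  · obtain ⟨i, hi, hij⟩ : ∃ i : ℕ, i < 4 * g ∧ sideDir g j = sideDir g i := by
      refine ⟨(j % (4 * g)).toNat, ?_, ?_⟩
      · have := Int.emod_lt_of_pos j (by omega : (0 : ℤ) < 4 * g)
        omega
      · have h0 := Int.emod_nonneg j (by omega : (4 * g : ℤ) ≠ 0)
        rw [Int.toNat_of_nonneg h0, ← sideDir_add hg (j % (4 * g)) (j / (4 * g))]
        congr 1
        have := Int.emod_add_mul_ediv j (4 * g)
        linarith
    obtain ⟨m, ht, hu, hm, hm'⟩ := exists_midpoint hg i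
    have h1 := key m ⟨m, Or.inr ⟨i, hi, hm, hm'⟩, rfl⟩
    have hs := sin_ang_pos hg
    have h2 := mul_le_mul_of_nonneg_right h1 hs.le
    have e : coshDist (h C) m * Real.sin (ang g) =
        Real.cos (ang g) * time (h C) - rad g * (space (h C) * conj (sideDir g j)).re := by
      simp only [coshDist, ht, hu, hij, mul_re, mul_im, conj_re, conj_im, ofReal_re, ofReal_im]
      field_simp
      ring
    rwa [e] at h2

theorem hconvexHull_subset_neighborhood {g : ℕ} (hg : 2 ≤ g) {P : Set 𝔻} {t : Finset 𝔻}
    (hP : proj g hg ⁻¹' weierstrassPoints g hg ⊆ P) (ht : IsDelaunayTriangle P t)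
    (hv : ∃ v ∈ t, v ∈ originalDomain g hg) : hconvexHull (t : Set 𝔻) ⊆ neighborhood g hg := by
  obtain ⟨-, -, c, r, hr, hempty⟩ := ht
  obtain ⟨v, hvt, hv⟩ := hv
  have hr0 : 0 ≤ r := by
    rw [← hr v hvt]
    exact hdist_nonneg c v
  intro x hx
  have hxr : hdist c x ≤ r :=
    hconvexHull_subset (hconvex_closedBall c r) (fun w hw => (hr w hw).le) hx
  exact mem_neighborhood hg (k := Real.cosh r) (C := c)
    (fun h hh => isClear_of_empty hg hP (fun p hp => (le_hdist_iff hr0).1 (hempty p hp)) hh)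
    (originalDomain_subset_polygon hg hv) ((hdist_le_iff hr0).1 (hr v hvt).le)
    ((hdist_le_iff hr0).1 hxr)

end Bolza

end

theorem mainTheorem9 (g : ℕ) (hg : 2 ≤ g) (Q : Set (Bolza.Surface g hg)) (hfin : Q.Finite)
    (hW : Bolza.weierstrassPoints g hg ⊆ Q) :
    (∀ T : Set (Finset Complex.UnitDisc), Bolza.IsDelaunayTriangulation (Bolza.proj g hg ⁻¹' Q) T →
      ∀ t ∈ T, (∃ v ∈ t, v ∈ Bolza.originalDomain g hg) →
        Bolza.hconvexHull (t : Set Complex.UnitDisc) ⊆ Bolza.neighborhood g hg) ∧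
    (∀ t : Finset Complex.UnitDisc, Bolza.IsDelaunayTriangle (Bolza.proj g hg ⁻¹' Q) t →
      (∃ v ∈ t, v ∈ Bolza.originalDomain g hg) →
        Bolza.hconvexHull (t : Set Complex.UnitDisc) ⊆ Bolza.neighborhood g hg) :=
  ⟨fun _ hT _ ht hv =>
      Bolza.hconvexHull_subset_neighborhood hg (Set.preimage_mono hW) (hT.delaunay _ ht) hv,
    fun _ ht hv => Bolza.hconvexHull_subset_neighborhood hg (Set.preimage_mono hW) ht hv⟩
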